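/- **Setting.** Let $\mathfrak H=\mathbb Q\langle e_0,e_1\rangle$ be the algebra of noncommutative polynomials and $\mathfrak H^1=\mathbb Q\cdot 1+e_1\mathfrak H$; with $e_k=e_1e_0^{k-1}$ for $k\ge 1$, the words $e_{k_1}\cdots e_{k_r}$ ($r\ge 0$, $k_i\geq 1$) form a $\mathbb Q$-basis of $\mathfrak H^1$. Let $\mathrm{sh}$ be the shuffle product on $\mathfrak H$ (which restricts to $\mathfrak H^1$), i.e. the $\mathbb Q$-bilinear product with $1\mathbin{\mathrm{sh}} w=w\mathbin{\mathrm{sh}} 1=w$ and $av\mathbin{\mathrm{sh}} bw=a(v\mathbin{\mathrm{sh}} bw)+b(av\mathbin{\mathrm{sh}} w)$ for $a,b\in\{e_0,e_1\}$. Let $\ast$ be the harmonic product on $\mathfrak H^1$, i.e. the $\mathbb Q$-bilinear product with $1\ast w=w\ast 1=w$ and $e_av\ast e_bw=e_a(v\ast e_bw)+e_b(e_av\ast w)+e_{a+b}(v\ast w)$. Put $\mathrm{ds}(u,v)=u\ast v-u\mathbin{\mathrm{sh}} v\in\mathfrak H^1$. For $k_1,\dots,k_r\ge 1$ and $d_1,\dots,d_r\ge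 0$ let $$g^{(d_1,\dots,d_r)}_{k_1,\dots,k_r}=\sum_{\substack{0<u_1<\dots<u_r\\ 0<v_1,\dots,v_r}}\ \prod_{i=1}^r\frac{u_i^{d_i}}{d_i!}\,\frac{v_i^{k_i-1}}{(k_i-1)!}\; q^{u_1v_1+\dots+u_rv_r}\in\mathbb Q[[q]].$$ For $n_1,\dots,n_m\ge 1$ put $$H\binom{n_1,\dots,n_m}{X_1,\dots,X_m}=\sum_{0<d_1<\dots<d_m}\ \prod_{j=1}^m e^{d_jX_j}\Big(\frac{q^{d_j}}{1-q^{d_j}}\Big)^{n_j},$$ and define $g^{\mathrm{sh}}_{k_1,\dots,k_r}\in\mathbb Q[[q]]$ ($r \geq 1$, $k_i\ge 1$) by $$\sum_{k_1,\dots,k_r\ge 1}g^{\mathrm{sh}}_{k_1,\dots,k_r}X_1^{k_1-1}\cdots X_r^{k_r-1}=\sum_{m=1}^r\ \sum_{\substack{i_1+\dots+i_m=r\\ i_1,\dots,i_m\ge 1}}\frac1{i_1!\cdots i_m!}\,H\binom{i_1,\,i_2,\,\dots,\,i_m}{X_r-X_{r-i_1},\,X_{r-i_1}-X_{r-i_1-i_2},\,\dots,\,X_{i_m}},$$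 with $g^{\mathrm{sh}}=1$ for $r=0$. Let $\mathfrak g^{\mathrm{sh}}:\mathfrak H^1\to\mathbb Q[[q]]$ be the $\mathbb Q$-linear map with $e_{k_1}\cdots e_{k_r}\mapsto g^{\mathrm{sh}}_{k_1,\dots,k_r}$, and let $\mathcal G^{\mathrm{sh}}_{\le k}$ be the $\mathbb Q$-span of all $g^{\mathrm{sh}}_{k_1,\dots,k_r}$ with $r\ge 0$ and $k_1+\dots+k_r\le k$. Finally $\delta_{a,b}$ is the Kronecker delta. **Lemma.** Let $k_1,k_2,k_3,k_4\ge 1$ be integers such that there is exactly one index $1\le j\le 4$ with $k_j=1$, and put $k=k_1+k_2+k_3+k_4$. Then: 1. Modulo $\mathcal G^{\mathrm{sh}}_{\le k_1+k_2+k_3-1}$, $$\mathfrak g^{\mathrm{sh}}(\mathrm{ds}(e_{k_1},e_{k_2}e_{k_3}))\equiv\tfrac12\delta_{k_1,1}\,g^{(0,1)}_{k_2,k_3}+\tfrac12\delta_{k_3,1}\big(g^{(0,1)}_{k_2,k_1}-g^{(1,0)}_{k_2,k_1}\big).$$ 2. Modulo $\mathcal G^{\mathrm{sh}}_{\le k-1}$,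 $$\mathfrak g^{\mathrm{sh}}(\mathrm{ds}(e_{k_1},e_{k_2}e_{k_3}e_{k_4}))\equiv\tfrac12\delta_{k_1,1}\,g^{(0,0,1)}_{k_2,k_3,k_4}+\tfrac12\delta_{k_4,1}\big(g^{(0,0,1)}_{k_2,k_3,k_1}-g^{(0,1,0)}_{k_2,k_3,k_1}\big).$$ 3. Modulo $\mathcal G^{\mathrm{sh}}_{\le k-1}$, $$\begin{aligned}\mathfrak g^{\mathrm{sh}}(\mathrm{ds}(e_{k_1}e_{k_2},e_{k_3}e_{k_4}))\equiv{}&\tfrac12\delta_{k_2,1}\big(g^{(0,0,1)}_{k_1,k_3,k_4}-g^{(1,0,0)}_{k_1,k_3,k_4}+g^{(0,0,1)}_{k_3,k_1,k_4}-g^{(0,1,0)}_{k_3,k_1,k_4}\big)\\&+\tfrac12\delta_{k_2,1}\big(g^{(0,1)}_{k_1+k_3,k_4}-g^{(1,0)}_{k_1+k_3,k_4}\big)\\&+\tfrac12\delta_{k_4,1}\big(g^{(0,0,1)}_{k_1,k_3,k_2}-g^{(0,1,0)}_{k_1,k_3,k_2}+g^{(0,0,1)}_{k_3,k_1,k_2}-g^{(1,0,0)}_{k_3,k_1,k_2}\big)\\&+\tfrac12\delta_{k_4,1}\big(g^{(0,1)}_{k_1+k_3,k_2}-g^{(1,0)}_{k_1+k_3,k_2}\big).\end{aligned}$$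 -/

import Mathlib

open scoped Nat PowerSeries

namespace MultEis

/-! ### Noncommutative polynomials and the two products -/

/-- `ℚ⟨α⟩`: noncommutative polynomials over `ℚ` in the indeterminates `α`, with basis the words in
`α`. Its ring multiplication is concatenation of words. -/
abbrev NCPoly (α : Type) : Type := MonoidAlgebra ℚ (FreeMonoid α)

/-- The word `w`, as an element of `ℚ⟨α⟩`. -/
noncomputable def word {α : Type} (w : List α) : NCPoly α :=
  MonoidAlgebra.single (FreeMonoid.ofList w) 1

/-- The `ℚ`-linear map on `ℚ⟨α⟩` with prescribed values on words. -/
noncomputable def linExt {α M : Type} [AddCommGroup M] [Module ℚ M] (f : List α → M) :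
    NCPoly α →ₗ[ℚ] M :=
  Finsupp.linearCombination ℚ (fun w : FreeMonoid α => f w.toList) ∘ₗ
    (MonoidAlgebra.coeffLinearEquiv ℚ : NCPoly α ≃ₗ[ℚ] (FreeMonoid α →₀ ℚ)).toLinearMap

/-- The algebra `𝔥 = ℚ⟨e₀, e₁⟩`; the letter `e₀` is `0 : Fin 2`, the letter `e₁` is `1 : Fin 2`. -/
abbrev H : Type := NCPoly (Fin 2)

/-- The algebra `𝔥¹`, presented as the free algebra on the letters `e_k`, `k ≥ 1`. It is identified
with the subalgebra `ℚ·1 + e₁𝔥` of `𝔥` through `H1.toH`. -/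
abbrev H1 : Type := NCPoly ℕ+

/-- The letter `e_k` of `𝔥¹`. -/
noncomputable def e (k : ℕ+) : H1 := word [k]

/-- The shuffle product of two words in `e₀, e₁`. -/
noncomputable def shuffleWord : List (Fin 2) → List (Fin 2) → H
  | [], w => word w
  | a :: v, [] => word (a :: v)
  | a :: v, b :: w => word [a] * shuffleWord v (b :: w) + word [b] * shuffleWord (a :: v) w
  termination_by u v => u.length + v.length

/-- The shuffle product on `𝔥`. -/
noncomputable def shuffle : H →ₗ[ℚ] H →ₗ[ℚ] H :=
  linExt fun u => linExt fun v => shuffleWord u v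

/-- The harmonic (stuffle) product of two words in the letters `e_k`. -/
noncomputable def stuffleWord : List ℕ+ → List ℕ+ → H1
  | [], w => word w
  | a :: v, [] => word (a :: v)
  | a :: v, b :: w => e a * stuffleWord v (b :: w) + e b * stuffleWord (a :: v) w
      + e (a + b) * stuffleWord v w
  termination_by u v => u.length + v.length

/-- The harmonic (stuffle) product on `𝔥¹`. -/
noncomputable def stuffle : H1 →ₗ[ℚ] H1 →ₗ[ℚ] H1 :=
  linExt fun u => linExt fun v => stuffleWord u v

/-- The word `e_{k₁} ⋯ e_{k_r}` written in `e₀, e₁`, where `e_k = e₁ e₀^{k-1}`. -/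
def encode : List ℕ+ → List (Fin 2)
  | [] => []
  | k :: w => 1 :: (List.replicate ((k : ℕ) - 1) 0 ++ encode w)

/-- Auxiliary to `decode`: the number of leading `e₀`s of a word in `e₀, e₁`, and the word in the
letters `e_k` which follows them. -/
def decodeAux : List (Fin 2) → ℕ × List ℕ+
  | [] => (0, [])
  | a :: w => if a = 0 then ((decodeAux w).1 + 1, (decodeAux w).2)
      else (0, ⟨(decodeAux w).1 + 1, Nat.succ_pos _⟩ :: (decodeAux w).2)

/-- The inverse of `encode` on the words in `e₀, e₁` that do not begin with `e₀`. -/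
def decode (w : List (Fin 2)) : List ℕ+ := (decodeAux w).2

/-- The embedding `𝔥¹ → 𝔥`, `e_k ↦ e₁ e₀^{k-1}`. -/
noncomputable def H1.toH : H1 →ₗ[ℚ] H := linExt fun w => word (encode w)

/-- The linear map `𝔥 → 𝔥¹` which is inverse to the embedding on `ℚ·1 + e₁𝔥`
(see `H1.ofH_toH`, `H1.range_toH`); only its values there are used. -/
noncomputable def H1.ofH : H →ₗ[ℚ] H1 := linExt fun w => word (decode w)

/-- The shuffle product on `𝔥¹`, i.e. the shuffle product of `𝔥` restricted to `𝔥¹`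
(see `H1.toH_shuffle`). -/
noncomputable def H1.shuffle (u v : H1) : H1 := H1.ofH (MultEis.shuffle (H1.toH u) (H1.toH v))

/-- `ds(u, v) = u ∗ v - u ш v`. -/
noncomputable def ds (u v : H1) : H1 := stuffle u v - H1.shuffle u v

/-! The identification of `𝔥¹` with a subalgebra of `𝔥` is justified by the following facts. -/

theorem linExt_word {α M : Type} [AddCommGroup M] [Module ℚ M] (f : List α → M) (w : List α) :
    linExt f (word w) = f w := by
  simp [linExt, word]

theorem NCPoly.hom_ext {α M : Type} [AddCommGroup M] [Module ℚ M] {f g : NCPoly α →ₗ[ℚ] M}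
    (h : ∀ w, f (word w) = g (word w)) : f = g := by
  ext w
  exact h w.toList

theorem word_mul {α : Type} (v w : List α) : word v * word w = word (v ++ w) := by
  simp [word, MonoidAlgebra.single_mul_single]

theorem decodeAux_encode (n : ℕ) (w : List ℕ+) :
    decodeAux (List.replicate n 0 ++ encode w) = (n, w) := by
  induction w generalizing n with
  | nil =>
    induction n with
    | zero => rfl
    | succ n ih => simp [List.replicate_succ, decodeAux, ih]
  | cons k w ihw =>
    induction n with
    | zero =>
      simp only [encode, List.replicate_zero, List.nil_append, decodeAux, ihw]
      have : (k : ℕ) - 1 + 1 = k := Nat.sub_add_cancel k.pos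
      simp only [this]
      rfl
    | succ n ih =>
      simp only [List.replicate_succ, List.cons_append, decodeAux, ih]
      simp

theorem decode_encode (w : List ℕ+) : decode (encode w) = w := by
  have := decodeAux_encode 0 w
  simp only [List.replicate_zero, List.nil_append] at this
  simp [decode, this]

theorem encode_decodeAux (w : List (Fin 2)) :
    List.replicate (decodeAux w).1 0 ++ encode (decodeAux w).2 = w := by
  induction w with
  | nil => rfl
  | cons a w ih =>
    by_cases ha : a = 0
    · simp [decodeAux, ha, List.replicate_succ, ih]
    · have : a = 1 := by omega
      subst this
      simp [decodeAux, encode, ih]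

theorem encode_decode_cons (w : List (Fin 2)) : encode (decode (1 :: w)) = 1 :: w := by
  have := encode_decodeAux (1 :: w)
  simpa [decodeAux, decode] using this

theorem H1.ofH_toH (u : H1) : H1.ofH (H1.toH u) = u := by
  have : H1.ofH ∘ₗ H1.toH = LinearMap.id :=
    NCPoly.hom_ext fun w => by simp [H1.ofH, H1.toH, linExt_word, decode_encode]
  exact LinearMap.congr_fun this u

theorem H1.toH_word (w : List ℕ+) : H1.toH (word w) = word (encode w) := linExt_word _ _

theorem H1.toH_one : H1.toH 1 = 1 := H1.toH_word []

theorem encode_append (v w : List ℕ+) : encode (v ++ w) = encode v ++ encode w := by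
  induction v with
  | nil => rfl
  | cons k v ih => simp [encode, ih]

theorem H1.toH_mul (u v : H1) : H1.toH (u * v) = H1.toH u * H1.toH v := by
  have : (LinearMap.mul ℚ H1).compr₂ H1.toH = (LinearMap.mul ℚ H).compl₁₂ H1.toH H1.toH :=
    NCPoly.hom_ext fun v => NCPoly.hom_ext fun w => by
      simp [word_mul, H1.toH_word, encode_append]
  exact LinearMap.congr_fun₂ this u v

theorem H1.toH_e (k : ℕ+) : H1.toH (e k) = word [1] * word [0] ^ ((k : ℕ) - 1) := by
  have h (n : ℕ) : (word [0] : H) ^ n = word (List.replicate n 0) := by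
    induction n with
    | zero => rfl
    | succ n ih => rw [pow_succ', ih, word_mul]; rfl
  rw [h, word_mul, e, H1.toH_word]
  simp [encode]

theorem H1.toH_ofH_e1_mul (x : H) : H1.toH (H1.ofH (word [1] * x)) = word [1] * x := by
  have : H1.toH ∘ₗ H1.ofH ∘ₗ LinearMap.mulLeft ℚ (word [1]) = LinearMap.mulLeft ℚ (word [1]) :=
    NCPoly.hom_ext fun w => by
      simp [word_mul, H1.ofH, H1.toH, linExt_word, encode_decode_cons]
  exact LinearMap.congr_fun this x

/-- The image of the embedding is the subspace `ℚ·1 + e₁𝔥`. -/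
theorem H1.range_toH : LinearMap.range H1.toH
    = Submodule.span ℚ {1} ⊔ LinearMap.range (LinearMap.mulLeft ℚ (word [1] : H)) := by
  apply le_antisymm
  · rintro _ ⟨u, rfl⟩
    have : ∀ u : H1, u ∈ (Submodule.span ℚ {1} ⊔
        LinearMap.range (LinearMap.mulLeft ℚ (word [1] : H))).comap H1.toH := by
      intro u
      induction u using MonoidAlgebra.induction_linear with
      | zero => exact Submodule.zero_mem _
      | add x y hx hy => exact Submodule.add_mem _ hx hy
      | single w c =>
        have : (MonoidAlgebra.single w c : H1) = c • word w.toList := by simp [word]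
        rw [this]
        refine Submodule.smul_mem _ _ ?_
        rw [Submodule.mem_comap, H1.toH_word]
        cases w.toList with
        | nil => exact Submodule.mem_sup_left (Submodule.mem_span_singleton_self _)
        | cons k w =>
          refine Submodule.mem_sup_right ⟨word (List.replicate ((k : ℕ) - 1) 0 ++ encode w), ?_⟩
          simp [word_mul, encode]
    exact this u
  · refine sup_le ?_ ?_
    · rw [Submodule.span_singleton_le_iff_mem]
      exact ⟨1, H1.toH_one⟩
    · rintro _ ⟨x, rfl⟩
      exact ⟨_, H1.toH_ofH_e1_mul x⟩

/-- `𝔥¹` is closed under the shuffle product of `𝔥`, and `H1.shuffle` is its restriction. -/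
theorem H1.toH_shuffle (u v : H1) :
    H1.toH (H1.shuffle u v) = MultEis.shuffle (H1.toH u) (H1.toH v) := by
  have : ((MultEis.shuffle.compl₁₂ H1.toH H1.toH).compr₂ (H1.toH ∘ₗ H1.ofH))
      = MultEis.shuffle.compl₁₂ H1.toH H1.toH := by
    refine NCPoly.hom_ext fun v => NCPoly.hom_ext fun w => ?_
    simp only [LinearMap.compr₂_apply, LinearMap.compl₁₂_apply, LinearMap.comp_apply, H1.toH_word,
      MultEis.shuffle, linExt_word]
    have hw (w : List ℕ+) : H1.toH (H1.ofH (word (encode w))) = word (encode w) := by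
      rw [← H1.toH_word, H1.ofH_toH]
    cases v with
    | nil => simpa [encode, shuffleWord] using hw w
    | cons a v =>
      cases w with
      | nil => simpa [encode, shuffleWord] using hw (a :: v)
      | cons b w => simp [encode, shuffleWord, H1.toH_ofH_e1_mul]
  exact LinearMap.congr_fun₂ this u v

/-! ### The `q`-series -/

/-- The bi-bracket `g^{(d₁,…,d_r)}_{k₁,…,k_r}`, the formal power series in `q`
`∑_{0 < u₁ < ⋯ < u_r, 0 < v₁, …, v_r} ∏ᵢ uᵢ^{dᵢ} / dᵢ! * vᵢ^{kᵢ-1} / (kᵢ-1)! * q^{u₁v₁ + ⋯ + u_rv_r}`.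
A pair `(u, v)` that contributes to the coefficient of `q^n` has `uᵢ, vᵢ ≤ n`. -/
noncomputable def g {r : ℕ} (d : Fin r → ℕ) (k : Fin r → ℕ+) : ℚ⟦X⟧ :=
  PowerSeries.mk fun n =>
    ∑ p ∈ (Fintype.piFinset (fun _ : Fin r => Finset.Icc 1 n) ×ˢ
        Fintype.piFinset (fun _ : Fin r => Finset.Icc 1 n)).filter
        (fun p : (Fin r → ℕ) × (Fin r → ℕ) => StrictMono p.1 ∧ ∑ i, p.1 i * p.2 i = n),
      ∏ i, ((p.1 i : ℚ) ^ d i / (d i)! * ((p.2 i : ℚ) ^ ((k i : ℕ) - 1) / ((k i : ℕ) - 1)!))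

/-- The series `q^d / (1 - q^d)` (for `d ≥ 1`). -/
noncomputable def qFrac (d : ℕ) : ℚ⟦X⟧ := PowerSeries.X ^ d * (1 - PowerSeries.X ^ d)⁻¹

/-- The series `∑_{0 < d₁ < ⋯ < d_m} ∏ⱼ e^{dⱼ Lⱼ} (q^{dⱼ} / (1 - q^{dⱼ}))^{nⱼ}` with
exponents `nⱼ ≥ 1`, for power series `Lⱼ` in `X₁, …, X_r` without constant term. It is a power
series in `q` over `ℚ⟦X₁, …, X_r⟧`; a tuple `d` that contributes to the coefficient of `q^N` has
`dⱼ ≤ N`. -/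
noncomputable def HSeries {m r : ℕ} (n : Fin m → ℕ) (L : Fin m → MvPowerSeries (Fin r) ℚ) :
    PowerSeries (MvPowerSeries (Fin r) ℚ) :=
  PowerSeries.mk fun N =>
    ∑ d ∈ (Fintype.piFinset (fun _ : Fin m => Finset.Icc 1 N)).filter
        (fun d : Fin m → ℕ => StrictMono d),
      PowerSeries.coeff N (∏ j, qFrac (d j) ^ n j) •
        ∏ j, (PowerSeries.exp ℚ).subst ((d j : ℚ) • L j)

/-- The variable `X_i` of `ℚ⟦X₁, …, X_r⟧` for `1 ≤ i ≤ r`, with the convention `X₀ = 0`. -/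
noncomputable def var (r i : ℕ) : MvPowerSeries (Fin r) ℚ :=
  if h : 1 ≤ i ∧ i ≤ r then MvPowerSeries.X ⟨i - 1, by omega⟩ else 0

/-- The generating series
`T_ш(X₁, …, X_r) = ∑_{i₁ + ⋯ + i_m = r} 1 / (i₁! ⋯ i_m!) *
  H(i₁, …, i_m; X_r - X_{r-i₁}, X_{r-i₁} - X_{r-i₁-i₂}, …, X_{i_m})`,
the sum being over all compositions of `r`. -/
noncomputable def Tsh (r : ℕ) : PowerSeries (MvPowerSeries (Fin r) ℚ) :=
  ∑ c : Composition r, (∏ j, ((c.blocksFun j)! : ℚ)⁻¹) •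
    HSeries c.blocksFun
      (fun j : Fin c.length =>
        var r (r - c.sizeUpTo (j : ℕ)) - var r (r - c.sizeUpTo ((j : ℕ) + 1)))

/-- The `q`-series `g^ш_{k₁,…,k_r}`: the coefficient of `X₁^{k₁-1} ⋯ X_r^{k_r-1}` in `T_ш`
(equal to `1` for `r = 0`). -/
noncomputable def gshSeries (k : List ℕ+) : ℚ⟦X⟧ :=
  PowerSeries.mk fun N =>
    MvPowerSeries.coeff (Finsupp.equivFunOnFinite.symm fun i => (k.get i : ℕ) - 1)
      (PowerSeries.coeff N (Tsh k.length))

/-- The `ℚ`-linear map `𝔤^ш : 𝔥¹ → ℚ⟦q⟧`, `e_{k₁} ⋯ e_{k_r} ↦ g^ш_{k₁,…,k_r}`. -/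
noncomputable def gsh : H1 →ₗ[ℚ] ℚ⟦X⟧ := linExt gshSeries

/-- The space `𝒢^ш_{≤ k}` spanned by the series `g^ш_{k₁,…,k_r}` with `r ≥ 0` and
`k₁ + ⋯ + k_r ≤ k`. -/
noncomputable def GshLE (k : ℕ) : Submodule ℚ ℚ⟦X⟧ :=
  Submodule.span ℚ {f | ∃ w : List ℕ+, (w.map (fun a => (a : ℕ))).sum ≤ k ∧ f = gshSeries w}

/-- The Kronecker delta `δ_{a,1}`. -/
def delta1 (a : ℕ+) : ℚ := if a = 1 then 1 else 0

end MultEis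

open MultEis

namespace MultEis

/-! ### Exponentials of linear forms in several variables. -/

section Exp
variable {σ : Type}

/-! The map `gsh` turns the shuffle product into the product of `q`-series (`gsh_shuffle`), so the
image of ds(u, v) is `gsh` of the harmonic product minus gsh(u) · gsh(v). The lemma therefore
measures how far `gsh` is from being a homomorphism for the harmonic product (`gsh_ds`).

Why `gsh` is a shuffle homomorphism: extracting coefficients from the generating series writes g^ш
of a word as a sum over chains of indices d, weighted by divided powers of gaps and by a_d^n / n!
with a_d = q^d / (1 - q^d) (`coeff_gshSeries`). The same sums are the coefficients of the ordered
product of the factors exp(a_d e₁) exp(e₀) with d decreasing (`pathFunctional_encode`). Each factor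
is grouplike, so the product defines a character of the shuffle algebra.

Why the harmonic product almost works: expand a_d geometrically and exchange the gaps with the
resulting summation variables (`sum_transport`). If no two adjacent letters are e₁, g^ш becomes a
nested sum over u₁ < ⋯ < u_r of letters B_{k₁}, …, B_{k_{r-1}}, A_{k_r} (`truncFamily_gshSeries`).
Here A_k(u) is the sum of v^{k-1}/(k-1)! q^{uv} over v ≥ 1, and B_k = A_k + δ_{k,1}/2; the half
comes from a_d^2/2!, when an e₁ shares its index with the following letter. Nested sums multiply by
the quasi-shuffle rule (`letterSum_mul`).

Comparing the two products term by term leaves two defects. Merged letters differ, A_{a+b} against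
A_a A_b with possible half-shifts, but only by A_j with 2 ≤ j < a + b (`letter_merge_mem`), which
gives lower weight. And a letter that is last in its factor but not in the product contributes A_k
where B_k is wanted; likewise a one-letter factor. For k = 1 this leaves half a nested sum with a
constant letter 1, that is, a free index. Summing out the free index counts the integers between its
neighbours (`letterSum_one_cons`, `letterSum_insert_one`). This inserts factors u_i and produces
exactly the stated bi-brackets, plus plain nested sums of weight at most k - 1.

All identities between infinite sums are checked modulo q^{N+1} for every N at once (`truncFamily`),
where the sums are finite. -/

theorem exp_subst_add {a b : MvPowerSeries σ ℚ} (ha : MvPowerSeries.constantCoeff a = 0)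
    (hb : MvPowerSeries.constantCoeff b = 0) :
    (PowerSeries.exp ℚ).subst (a + b) = (PowerSeries.exp ℚ).subst a * (PowerSeries.exp ℚ).subst b := by
  -- Two independent variables suffice: there the identity is the binomial theorem, coefficient by
  -- coefficient, and substituting (a, b) gives the general case.
  have key : (PowerSeries.exp ℚ).subst (MvPowerSeries.X 0 + MvPowerSeries.X 1 : MvPowerSeries (Fin 2) ℚ)
      = (PowerSeries.exp ℚ).subst (MvPowerSeries.X 0 : MvPowerSeries (Fin 2) ℚ)
        * (PowerSeries.exp ℚ).subst (MvPowerSeries.X 1 : MvPowerSeries (Fin 2) ℚ) := by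
    ext e
    rw [PowerSeries.coeff_subst_X_zero_add_X_one, PowerSeries.coeff_subst_X_zero_subst_mul_X_one]
    simp only [PowerSeries.coeff_exp, Algebra.algebraMap_self, RingHom.id_apply]
    rw [Nat.cast_add_choose]
    have := Nat.factorial_ne_zero (e 0 + e 1)
    field_simp
  have hs : MvPowerSeries.HasSubst (![a, b] : Fin 2 → MvPowerSeries σ ℚ) :=
    MvPowerSeries.hasSubst_of_constantCoeff_zero (fun i => by fin_cases i <;> simp [ha, hb])
  have h := congrArg (MvPowerSeries.subst (![a, b] : Fin 2 → MvPowerSeries σ ℚ)) key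
  have hX (i : Fin 2) : PowerSeries.HasSubst (MvPowerSeries.X i : MvPowerSeries (Fin 2) ℚ) :=
    PowerSeries.HasSubst.X i
  rw [MvPowerSeries.subst_mul hs] at h
  simp only [PowerSeries.subst] at h ⊢
  rw [MvPowerSeries.subst_comp_subst_apply ((hX 0).add (hX 1)).const hs,
    MvPowerSeries.subst_comp_subst_apply (hX 0).const hs,
    MvPowerSeries.subst_comp_subst_apply (hX 1).const hs] at h
  simpa [MvPowerSeries.subst_add hs, MvPowerSeries.subst_X hs] using h

theorem exp_subst_sum {ι : Type} (s : Finset ι) (a : ι → MvPowerSeries σ ℚ)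
    (ha : ∀ i ∈ s, MvPowerSeries.constantCoeff (a i) = 0) :
    ∏ i ∈ s, (PowerSeries.exp ℚ).subst (a i) = (PowerSeries.exp ℚ).subst (∑ i ∈ s, a i) := by
  classical
  induction s using Finset.induction_on with
  | empty =>
    simp only [Finset.prod_empty, Finset.sum_empty]
    rw [PowerSeries.subst_zero_eq_C_constantCoeff]; simp
  | insert i s hi ih =>
    rw [Finset.prod_insert hi, Finset.sum_insert hi, exp_subst_add, ih]
    · exact fun j hj => ha j (Finset.mem_insert_of_mem hj)
    · exact ha i (Finset.mem_insert_self _ _)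
    · rw [map_sum]; exact Finset.sum_eq_zero fun j hj => ha j (Finset.mem_insert_of_mem hj)

/-- The divided power `x ^ n / n!`. -/
noncomputable def dpow (x : ℚ) (n : ℕ) : ℚ := x ^ n / (n)!

theorem coeff_exp_subst_smul_X [DecidableEq σ] (c : ℚ) (i : σ) (e : σ →₀ ℕ) :
    MvPowerSeries.coeff e ((PowerSeries.exp ℚ).subst (c • (MvPowerSeries.X i : MvPowerSeries σ ℚ)))
      = if e = Finsupp.single i (e i) then dpow c (e i) else 0 := by
  have : (PowerSeries.exp ℚ).subst (c • (MvPowerSeries.X i : MvPowerSeries σ ℚ))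
      = (PowerSeries.rescale c (PowerSeries.exp ℚ)).subst (MvPowerSeries.X i : MvPowerSeries σ ℚ) := by
    rw [PowerSeries.rescale_eq_subst, PowerSeries.subst_comp_subst_apply
      (PowerSeries.HasSubst.smul_X' c) (PowerSeries.HasSubst.X i),
      PowerSeries.subst_smul (PowerSeries.HasSubst.X i), PowerSeries.subst_X (PowerSeries.HasSubst.X i)]
  rw [this, PowerSeries.coeff_subst_single]
  simp [PowerSeries.coeff_rescale, PowerSeries.coeff_exp, dpow, div_eq_mul_inv]

/-- The exponential of the sum is a product of exponentials in one variable each, so a single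
splitting of `e` contributes, the one giving each factor the full exponent of its own variable. -/
theorem coeff_exp_subst_linear [Fintype σ] [DecidableEq σ] (c : σ → ℚ) (e : σ →₀ ℕ) :
    MvPowerSeries.coeff e ((PowerSeries.exp ℚ).subst
      (∑ i, c i • (MvPowerSeries.X i : MvPowerSeries σ ℚ))) = ∏ i, dpow (c i) (e i) := by
  rw [← exp_subst_sum _ _ (fun i _ => by simp), MvPowerSeries.coeff_prod]
  simp only [coeff_exp_subst_smul_X]
  have key (l : σ →₀ σ →₀ ℕ) (hl : ∀ i, l i = Finsupp.single i (l i i)) (i : σ) :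
      (∑ j, l j) i = l i i := by
    rw [Finsupp.finsetSum_apply, Finset.sum_eq_single i]
    · intro j _ hj; rw [hl j]; simp [hj.symm]
    · simp
  rw [Finset.sum_eq_single (Finsupp.equivFunOnFinite.symm fun i => Finsupp.single i (e i))]
  · simp
  · intro l hl hne
    rw [Finset.mem_finsuppAntidiag] at hl
    by_contra h
    have h1 : ∀ i, l i = Finsupp.single i (l i i) := by
      intro i
      by_contra hi
      exact h (Finset.prod_eq_zero (Finset.mem_univ i) (if_neg hi))
    apply hne
    ext i : 1
    rw [h1 i, ← key l h1 i]
    rw [hl.1]; rfl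
  · intro h
    exfalso; apply h
    rw [Finset.mem_finsuppAntidiag]
    refine ⟨?_, fun _ _ => Finset.mem_univ _⟩
    ext i
    erw [key _ (fun i => by simp)]
    simp
end Exp

/-! ### Sums over increasing tuples for one fixed composition. -/

section Chains

/-- The strictly increasing `m`-tuples in `[1, M]`. -/
def incTuples (m M : ℕ) : Finset (Fin m → ℕ) :=
  (Fintype.piFinset (fun _ : Fin m => Finset.Icc 1 M)).filter (fun d : Fin m → ℕ => StrictMono d)

theorem mem_incTuples {m M : ℕ} {d : Fin m → ℕ} :
    d ∈ incTuples m M ↔ (∀ i, 1 ≤ d i ∧ d i ≤ M) ∧ StrictMono d := by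
  simp [incTuples, Fintype.mem_piFinset]

theorem strictMono_snoc {m : ℕ} {d : Fin m → ℕ} {t : ℕ} :
    StrictMono (Fin.snoc d t : Fin (m + 1) → ℕ) ↔ StrictMono d ∧ ∀ i, d i < t := by
  constructor
  · intro h
    refine ⟨fun i j hij => ?_, fun i => ?_⟩
    · simpa using h (Fin.castSucc_lt_castSucc_iff.2 hij)
    · simpa using h (Fin.castSucc_lt_last i)
  · rintro ⟨h1, h2⟩ i j hij
    induction j using Fin.lastCases with
    | last =>
      induction i using Fin.lastCases with
      | last => exact absurd hij (lt_irrefl _)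
      | cast i => simpa using h2 i
    | cast j =>
      induction i using Fin.lastCases with
      | last => exact absurd (hij.trans (Fin.castSucc_lt_last j)) (lt_irrefl _)
      | cast i => simpa using h1 (Fin.castSucc_lt_castSucc_iff.1 hij)

theorem sum_incTuples_succ {R : Type*} [AddCommMonoid R] {m M : ℕ} (G : (Fin (m + 1) → ℕ) → R) :
    ∑ d ∈ incTuples (m + 1) M, G d
      = ∑ t ∈ Finset.Icc 1 M, ∑ d ∈ incTuples m (t - 1), G (Fin.snoc d t) := by
  rw [Finset.sum_sigma']
  refine Finset.sum_bij' (fun d _ => ⟨d (Fin.last m), Fin.init d⟩) (fun x _ => Fin.snoc x.2 x.1)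
    ?_ ?_ ?_ ?_ ?_
  · intro d hd
    rw [mem_incTuples] at hd
    simp only [Finset.mem_sigma, Finset.mem_Icc, mem_incTuples]
    have hd2 := hd.2
    rw [← Fin.snoc_init_self d, strictMono_snoc] at hd2
    refine ⟨hd.1 _, fun i => ⟨(hd.1 _).1, ?_⟩, hd2.1⟩
    have := hd2.2 i
    omega
  · rintro ⟨t, d⟩ hx
    simp only [Finset.mem_sigma, Finset.mem_Icc, mem_incTuples] at hx
    rw [mem_incTuples, strictMono_snoc]
    obtain ⟨ht, hd, hmono⟩ := hx
    refine ⟨fun i => ?_, hmono, fun i => ?_⟩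
    · induction i using Fin.lastCases with
      | last => simpa using ht
      | cast i => have := hd i; simp only [Fin.snoc_castSucc]; omega
    · have := hd i
      simp only
      omega
  · intro d _; simp
  · rintro ⟨t, d⟩ _; simp
  · intro d _; simp

theorem incTuples_zero (M : ℕ) : incTuples 0 M = {default} := by
  ext d
  simp only [mem_incTuples, Finset.mem_singleton]
  exact ⟨fun _ => Subsingleton.elim _ _, fun _ => ⟨fun i => i.elim0, fun i => i.elim0⟩⟩

/-- The sum of the entries `b j'` with `j' ≥ j`. -/
def suffixSum {m : ℕ} (b : Fin m → ℕ) (j : ℕ) : ℕ := ∑ i : Fin m, if j ≤ (i : ℕ) then b i else 0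

theorem suffixSum_snoc {m : ℕ} (b : Fin m → ℕ) (β j : ℕ) :
    suffixSum (Fin.snoc b β : Fin (m + 1) → ℕ) j = suffixSum b j + if j ≤ m then β else 0 := by
  simp [suffixSum, Fin.sum_univ_castSucc]

theorem suffixSum_blocksFun {r : ℕ} (c : Composition r) {j : ℕ} (hj : j ≤ c.length) :
    r - c.sizeUpTo j = suffixSum c.blocksFun j := by
  suffices h : suffixSum c.blocksFun j + c.sizeUpTo j = r by omega
  induction j with
  | zero => simp [suffixSum, c.sum_blocksFun]
  | succ j ih =>
    refine Eq.trans ?_ (ih (by omega))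
    rw [c.sizeUpTo_succ (by omega)]
    have h : suffixSum c.blocksFun j = suffixSum c.blocksFun (j + 1) + c.blocksFun ⟨j, by omega⟩ := by
      have h2 : c.blocksFun ⟨j, by omega⟩
          = ∑ i : Fin c.length, if i = ⟨j, by omega⟩ then c.blocksFun i else 0 := by simp
      rw [h2, suffixSum, suffixSum, ← Finset.sum_add_distrib]
      refine Finset.sum_congr rfl fun i _ => ?_
      simp only [Fin.ext_iff]
      split_ifs <;> omega
    rw [h]
    simp only [Composition.blocksFun]
    rw [List.get_eq_getElem]
    ring

/-- The coefficient of `X_i` in `∑ⱼ dⱼ (X_{s_j} - X_{s_{j+1}})`, `s` the suffix sums of `b`. -/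
def gapCoeff {m : ℕ} (b d : Fin m → ℕ) (i : ℕ) : ℚ :=
  ∑ j : Fin m, (d j : ℚ) * ((if suffixSum b j = i then 1 else 0)
    - (if suffixSum b (j + 1) = i then 1 else 0))

/-- A new last part β shifts the earlier suffix sums by β, and the new top index t enters only
through X_β - X₀. The coefficient at 0 is kept although X₀ = 0: for positive parts it is minus the
largest index, which tells the recursion where the shorter chain stops. -/
theorem gapCoeff_snoc {m : ℕ} (b d : Fin m → ℕ) (β t i : ℕ) :
    gapCoeff (Fin.snoc b β : Fin (m + 1) → ℕ) (Fin.snoc d t : Fin (m + 1) → ℕ) i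
      = (if β ≤ i then gapCoeff b d (i - β) else 0)
        + t * ((if β = i then 1 else 0) - (if i = 0 then 1 else 0)) := by
  have h0 : suffixSum b m = 0 := by
    simp only [suffixSum]; exact Finset.sum_eq_zero fun i _ => if_neg (by omega)
  have h1 : suffixSum b (m + 1) = 0 := by
    simp only [suffixSum]; exact Finset.sum_eq_zero fun i _ => if_neg (by omega)
  rw [gapCoeff, Fin.sum_univ_castSucc]
  simp only [Fin.snoc_castSucc, Fin.snoc_last, suffixSum_snoc, Fin.val_castSucc, Fin.val_last, h0, h1]
  congr 1
  · split_ifs with hβ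
    · rw [gapCoeff]
      refine Finset.sum_congr rfl fun j _ => ?_
      have e1 : (suffixSum b j + (if (j : ℕ) ≤ m then β else 0) = i) ↔ suffixSum b j = i - β := by
        rw [if_pos (by omega)]; omega
      have e2 : (suffixSum b (j + 1) + (if (j : ℕ) + 1 ≤ m then β else 0) = i)
          ↔ suffixSum b (j + 1) = i - β := by
        rw [if_pos (by omega)]; omega
      simp only [e1, e2]
    · refine Finset.sum_eq_zero fun j _ => ?_
      rw [if_neg, if_neg]
      · simp
      · rw [if_pos (by omega)]; omega
      · rw [if_pos (by omega)]; omega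
  · simp [eq_comm]

variable {R : Type} [CommRing R] [Algebra ℚ R]

/-- Sums over chains with top element `d`, multiplicities `b` (largest first) and gap exponents
`κ`, the top multiplicity being raised by `i`. -/
noncomputable def blockChain (a : ℕ → R) : List ℕ → ℕ → (ℕ → ℕ) → ℕ → R
  | [], i, _, d => if i = 0 ∧ d = 0 then 1 else 0
  | β :: bs, i, κ, d => if ∀ j < β - 1, κ j = 0 then
      (((i + β)! : ℚ)⁻¹ • a d ^ (i + β)) * ∑ d' ∈ Finset.range d,
        dpow ((d : ℚ) - d') (κ (β - 1)) • blockChain a bs 0 (fun j => κ (j + β)) d'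
    else 0

theorem dpow_zero_left (n : ℕ) : dpow 0 n = if n = 0 then 1 else 0 := by
  cases n <;> simp [dpow]

/-- Within the top block only the last variable occurs in the linear form, with the gap between the
two largest indices as coefficient. The other variables have coefficient 0, which forces exponent 0.
-/
theorem prod_dpow_gapCoeff_snoc {m : ℕ} (b d : Fin m → ℕ) (β t s : ℕ) (κ : ℕ → ℕ) :
    ∏ i ∈ Finset.range (s + (β + 1)), dpow (gapCoeff (Fin.snoc b (β + 1) : Fin (m + 1) → ℕ)
        (Fin.snoc d t : Fin (m + 1) → ℕ) (i + 1)) (κ i)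
      = (if ∀ j < β, κ j = 0 then 1 else 0) * dpow (t + gapCoeff b d 0) (κ β)
        * ∏ i ∈ Finset.range s, dpow (gapCoeff b d (i + 1)) (κ (i + (β + 1))) := by
  rw [add_comm s, Finset.prod_range_add, Finset.prod_range_succ]
  congr 1
  · congr 1
    · have h (i : ℕ) (hi : i ∈ Finset.range β) : dpow (gapCoeff (Fin.snoc b (β + 1) : Fin (m + 1) → ℕ)
        (Fin.snoc d t : Fin (m + 1) → ℕ) (i + 1)) (κ i) = if κ i = 0 then 1 else 0 := by
        have := Finset.mem_range.1 hi
        rw [gapCoeff_snoc, if_neg (by omega), if_neg (by omega), if_neg (by omega)]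
        simp [dpow_zero_left]
      rw [Finset.prod_congr rfl h, Finset.prod_ite_zero]
      simp
    · rw [gapCoeff_snoc]; simp [add_comm]
  · refine Finset.prod_congr rfl fun i _ => ?_
    rw [gapCoeff_snoc, if_pos (by omega), if_neg (by omega), if_neg (by omega),
      show β + 1 + i + 1 - (β + 1) = i + 1 by omega, add_comm (β + 1) i]
    simp

theorem sum_Icc_one {S : Type*} [AddCommMonoid S] (f : ℕ → S) (M : ℕ) :
    ∑ x ∈ Finset.Icc 1 M, f x = ∑ x ∈ Finset.range M, f (x + 1) := by
  rw [← Nat.Ico_zero_eq_range, Finset.sum_Ico_add' f 0 M 1]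
  rfl

/-- The argument `-gapCoeff b d 0` is the largest index of the tuple, or 0 for the empty one. An
arbitrary weight `ψ` of that index is needed for the induction: removing the top index leaves a gap
factor that depends on the next one. -/
theorem sum_incTuples_gapCoeff (a : ℕ → R) {m : ℕ} (b : Fin m → ℕ) (hb : ∀ j, 0 < b j) (κ : ℕ → ℕ)
    (M : ℕ) (ψ : ℚ → R) :
    ∑ d ∈ incTuples m M, ψ (-gapCoeff b d 0) * ((∏ j, ((b j)! : ℚ)⁻¹ • a (d j) ^ b j)
        * algebraMap ℚ R (∏ i ∈ Finset.range (∑ j, b j), dpow (gapCoeff b d (i + 1)) (κ i)))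
      = ∑ t ∈ Finset.range (M + 1), ψ t * blockChain a (List.ofFn b).reverse 0 κ t := by
  induction m generalizing κ M ψ with
  | zero =>
    simp [incTuples_zero, gapCoeff, blockChain]
  | succ m ih =>
    obtain ⟨b, β, rfl⟩ : ∃ b' β, b = Fin.snoc b' β := ⟨Fin.init b, b (Fin.last m), by simp⟩
    have hβ := hb (Fin.last m)
    have hb' : ∀ j, 0 < b j := fun j => by simpa using hb j.castSucc
    simp only [Fin.snoc_last] at hβ
    obtain ⟨β, rfl⟩ : ∃ β', β = β' + 1 := ⟨β - 1, by omega⟩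
    rw [sum_incTuples_succ, Finset.sum_range_succ', List.ofFn_succ']
    simp only [Fin.snoc_castSucc, Fin.snoc_last, List.concat_eq_append, List.reverse_append,
      List.reverse_cons, List.reverse_nil, List.nil_append, List.cons_append, Fin.sum_univ_castSucc,
      prod_dpow_gapCoeff_snoc, Fin.prod_univ_castSucc, blockChain, Finset.range_zero, Finset.sum_empty,
      mul_zero, ite_self, add_zero, zero_add, Nat.add_sub_cancel]
    rw [sum_Icc_one]
    refine Finset.sum_congr rfl fun t _ => ?_
    have hg (d : Fin m → ℕ) : gapCoeff (Fin.snoc b (β + 1) : Fin (m + 1) → ℕ)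
        (Fin.snoc d (t + 1) : Fin (m + 1) → ℕ) 0 = - ((t + 1 : ℕ) : ℚ) := by
      rw [gapCoeff_snoc, if_neg (by omega), if_neg (by omega)]; simp
    simp only [hg, neg_neg, Nat.add_sub_cancel]
    split_ifs with hκ
    -- The new weight absorbs the removed block and the divided power of the gap below `t + 1`.
    · have := ih b hb' (fun j => κ (j + (β + 1))) t
        (fun x => ψ (t + 1 : ℕ) * ((((β + 1)! : ℚ)⁻¹ • a (t + 1) ^ (β + 1)) *
          algebraMap ℚ R (dpow ((t + 1 : ℕ) - x) (κ β))))
      rw [Finset.mul_sum, Finset.mul_sum]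
      refine Eq.trans ?_ (this.trans ?_)
      · refine Finset.sum_congr rfl fun d _ => ?_
        simp only [sub_neg_eq_add, one_mul, map_mul]
        ring
      · refine Finset.sum_congr rfl fun d _ => ?_
        rw [Algebra.smul_def (dpow _ _)]
        ring
    · simp

end Chains

/-! ### Recursion on compositions through their first part. -/

section Compositions

/-- The block lists of the compositions of `r`. -/
def blockLists (r : ℕ) : Finset (List ℕ) := Finset.univ.image fun c : Composition r => c.blocks

theorem mem_blockLists {r : ℕ} {l : List ℕ} : l ∈ blockLists r ↔ (∀ x ∈ l, 0 < x) ∧ l.sum = r := by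
  simp only [blockLists, Finset.mem_image, Finset.mem_univ, true_and]
  constructor
  · rintro ⟨c, rfl⟩; exact ⟨fun x hx => c.blocks_pos hx, c.blocks_sum⟩
  · rintro ⟨h1, h2⟩; exact ⟨⟨l, fun {i} hi => h1 i hi, h2⟩, rfl⟩

theorem sum_composition {R : Type*} [AddCommMonoid R] (r : ℕ) (f : List ℕ → R) :
    ∑ c : Composition r, f c.blocks.reverse = ∑ l ∈ blockLists r, f l := by
  refine Finset.sum_bij' (fun c _ => c.blocks.reverse)
    (fun l hl => ⟨l.reverse, fun {i} hi => (mem_blockLists.1 hl).1 i (List.mem_reverse.1 hi),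
      by rw [List.sum_reverse]; exact (mem_blockLists.1 hl).2⟩) ?_ ?_ ?_ ?_ ?_
  · intro c _
    rw [mem_blockLists]
    exact ⟨fun x hx => c.blocks_pos (List.mem_reverse.1 hx), by rw [List.sum_reverse, c.blocks_sum]⟩
  · intros; exact Finset.mem_univ _
  · intro c _; ext1; simp
  · intro l _; simp
  · intros; rfl

theorem blockLists_zero : blockLists 0 = {[]} := by
  ext l
  rw [mem_blockLists, Finset.mem_singleton]
  constructor
  · rintro ⟨h1, h2⟩
    cases l with
    | nil => rfl
    | cons a l => have := h1 a (by simp); simp at h2; omega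
  · rintro rfl; simp

/-- Increase the first entry of a list by one. -/
def incHead : List ℕ → List ℕ
  | [] => []
  | β :: l => (β + 1) :: l

/-- Either the first part is 1, or lowering it by one leaves a composition of `r`. These cases match
the two terms of the recursion of `chain`: the first letter closes its block, or shares its index
with the next letter. -/
theorem sum_blockLists_succ {R : Type*} [AddCommMonoid R] (r : ℕ) (f : List ℕ → R) :
    ∑ l ∈ blockLists (r + 1), f l = ∑ l ∈ blockLists r, f (1 :: l)
      + ∑ l ∈ (blockLists r).filter (· ≠ []), f (incHead l) := by
  have h : blockLists (r + 1) = (blockLists r).image (fun l => 1 :: l)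
      ∪ ((blockLists r).filter (· ≠ [])).image incHead := by
    ext l
    simp only [Finset.mem_union, Finset.mem_image, Finset.mem_filter, mem_blockLists]
    constructor
    · rintro ⟨h1, h2⟩
      match l with
      | [] => simp at h2
      | 0 :: l => exact absurd (h1 0 (by simp)) (lt_irrefl _)
      | 1 :: l =>
        exact Or.inl ⟨l, ⟨fun x hx => h1 x (by simp [hx]), by simp at h2; omega⟩, rfl⟩
      | (β + 2) :: l =>
        refine Or.inr ⟨(β + 1) :: l, ⟨⟨?_, by simp at h2 ⊢; omega⟩, by simp⟩, rfl⟩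
        intro x hx
        rcases List.mem_cons.1 hx with rfl | hx
        · omega
        · exact h1 x (by simp [hx])
    · rintro (⟨l, ⟨h1, h2⟩, rfl⟩ | ⟨l, ⟨⟨h1, h2⟩, h3⟩, rfl⟩)
      · exact ⟨by simpa using h1, by simp [h2]; omega⟩
      · cases l with
        | nil => exact absurd rfl h3
        | cons β l =>
          simp only [incHead]
          exact ⟨by simp at h1 ⊢; exact h1.2, by simp at h2 ⊢; omega⟩
  rw [h, Finset.sum_union, Finset.sum_image, Finset.sum_image]
  · intro l hl l' hl' e
    cases l <;> cases l' <;> simp_all [incHead]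
  · intro l _ l' _ e; simpa using e
  · rw [Finset.disjoint_left]
    intro l hl hl'
    simp only [Finset.mem_image, Finset.mem_filter, mem_blockLists] at hl hl'
    obtain ⟨l1, _, rfl⟩ := hl
    obtain ⟨l2, ⟨⟨h1, _⟩, h3⟩, h4⟩ := hl'
    cases l2 with
    | nil => exact h3 rfl
    | cons β l2 => have := h1 β (by simp); simp [incHead] at h4; omega

end Compositions

/-! ### Sums over all compositions, regrouped letter by letter. -/

section Chains
variable {R : Type} [CommRing R] [Algebra ℚ R]

/-- The part of the shuffle `q`-series of `k` whose largest summation index is `d`; the argument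
`i` counts the letters already placed at `d`. -/
noncomputable def chain (a : ℕ → R) : List ℕ+ → ℕ → ℕ → R
  | [], i, d => if i = 0 ∧ d = 0 then 1 else 0
  | k :: l, i, d => (((i + 1)! : ℚ)⁻¹ • a d ^ (i + 1)) * ∑ d' ∈ Finset.range d,
        dpow ((d : ℚ) - d') (k - 1) • chain a l 0 d'
      + if k = 1 then chain a l (i + 1) d else 0

/-- The exponents `k_j - 1` of a word, extended by zero. -/
def exponents (k : List ℕ+) (j : ℕ) : ℕ := (k.getD j 1 : ℕ) - 1

theorem exponents_cons_succ (k : ℕ+) (l : List ℕ+) (j : ℕ) :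
    exponents (k :: l) (j + 1) = exponents l j := rfl

theorem exponents_cons_zero (k : ℕ+) (l : List ℕ+) :
    exponents (k :: l) 0 = (k : ℕ) - 1 := rfl

theorem blockChain_incHead (a : ℕ → R) (l : List ℕ) (hl : ∀ x ∈ l, 0 < x) (hl' : l ≠ []) (i d : ℕ)
    (κ : ℕ → ℕ) :
    blockChain a (incHead l) i κ d
      = if κ 0 = 0 then blockChain a l (i + 1) (fun j => κ (j + 1)) d else 0 := by
  obtain ⟨β, l, rfl⟩ := List.exists_cons_of_ne_nil hl'
  obtain ⟨β, rfl⟩ : ∃ β', β = β' + 1 := ⟨β - 1, by have := hl β (by simp); omega⟩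
  simp only [incHead, blockChain, Nat.add_sub_cancel]
  have h1 : (∀ j < β + 1, κ j = 0) ↔ κ 0 = 0 ∧ ∀ j < β, κ (j + 1) = 0 := by
    constructor
    · exact fun h => ⟨h 0 (by omega), fun j hj => h _ (by omega)⟩
    · rintro ⟨h, h'⟩ (_ | j) hj
      · exact h
      · exact h' j (by omega)
  rw [show i + 1 + (β + 1) = i + (β + 1 + 1) by ring, if_congr h1 rfl rfl, ite_and]
  rfl

theorem sum_blockChain (a : ℕ → R) (k : List ℕ+) (i d : ℕ) :
    ∑ l ∈ blockLists k.length, blockChain a l i (exponents k) d = chain a k i d := by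
  induction k generalizing i d with
  | nil => simp [blockLists_zero, blockChain, chain]
  | cons k l ih =>
    rw [List.length_cons, sum_blockLists_succ, chain]
    congr 1
    · simp only [blockChain, Nat.sub_self, exponents_cons_succ, exponents_cons_zero]
      simp only [not_lt_zero, IsEmpty.forall_iff, implies_true, if_true]
      rw [← Finset.mul_sum, Finset.sum_comm]
      congr 1
      refine Finset.sum_congr rfl fun d' _ => ?_
      rw [← Finset.smul_sum, ← ih]
    · have h (l' : List ℕ) (hl' : l' ∈ (blockLists l.length).filter (· ≠ [])) :
          blockChain a (incHead l') i (exponents (k :: l)) d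
            = if (k : ℕ) - 1 = 0 then blockChain a l' (i + 1) (exponents l) d else 0 := by
        rw [Finset.mem_filter, mem_blockLists] at hl'
        exact blockChain_incHead a l' hl'.1.1 hl'.2 i d _
      rw [Finset.sum_congr rfl h]
      have hk : ((k : ℕ) - 1 = 0) ↔ k = 1 := by
        rw [← PNat.coe_eq_one_iff]; have := k.pos; omega
      simp only [hk]
      split_ifs with h
      · rw [← ih, Finset.sum_filter]
        refine Finset.sum_congr rfl fun l' _ => ?_
        cases l' <;> simp [blockChain]
      · simp
end Chains

/-! ### Coefficients of the shuffle q-series as chain sums. -/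

section Series

theorem var_eq_sum (r x : ℕ) :
    var r x = ∑ i : Fin r, (if x = (i : ℕ) + 1 then (1 : ℚ) else 0) •
      (MvPowerSeries.X i : MvPowerSeries (Fin r) ℚ) := by
  rw [var]
  split_ifs with h
  · rw [Finset.sum_eq_single ⟨x - 1, by omega⟩]
    · rw [if_pos (by simp; omega), one_smul]
    · intro j _ hj
      rw [if_neg, zero_smul]
      intro e; apply hj; ext; simp; omega
    · simp
  · rw [Finset.sum_eq_zero]
    intro j _
    rw [if_neg (by omega), zero_smul]

theorem coeff_prod_exp {m r : ℕ} (d : Fin m → ℕ) (x y : Fin m → ℕ) (e : Fin r →₀ ℕ) :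
    MvPowerSeries.coeff e (∏ j, (PowerSeries.exp ℚ).subst
        ((d j : ℚ) • (var r (x j) - var r (y j))))
      = ∏ i : Fin r, dpow (∑ j, (d j : ℚ) * ((if x j = i + 1 then 1 else 0)
          - (if y j = i + 1 then 1 else 0))) (e i) := by
  have h (j : Fin m) : ((d j : ℚ) • (var r (x j) - var r (y j)))
      = ∑ i : Fin r, ((d j : ℚ) * ((if x j = i + 1 then 1 else 0)
          - (if y j = i + 1 then 1 else 0))) • (MvPowerSeries.X i : MvPowerSeries (Fin r) ℚ) := by
    rw [var_eq_sum, var_eq_sum, ← Finset.sum_sub_distrib, Finset.smul_sum]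
    refine Finset.sum_congr rfl fun i _ => ?_
    rw [← sub_smul, smul_smul]
  rw [exp_subst_sum]
  · simp only [h]
    rw [Finset.sum_comm]
    simp only [← Finset.sum_smul]
    exact coeff_exp_subst_linear _ e
  · intro j _
    rw [h, map_sum]
    exact Finset.sum_eq_zero fun i _ => by simp

/-- In the linear form of a composition, X_r goes with the smallest index, so the first letter of
the word sits at the largest one. Hence the blocks are read in reverse order before summing over
compositions. -/
theorem coeff_gshSeries (k : List ℕ+) (N : ℕ) :
    PowerSeries.coeff N (gshSeries k)
      = PowerSeries.coeff N (∑ d ∈ Finset.range (N + 1), chain qFrac k 0 d) := by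
  have h : ∑ d ∈ Finset.range (N + 1), chain qFrac k 0 d
      = ∑ c : Composition k.length, ∑ d ∈ incTuples c.length N,
        (∏ j, ((c.blocksFun j)! : ℚ)⁻¹ • qFrac (d j) ^ c.blocksFun j)
        * algebraMap ℚ ℚ⟦X⟧ (∏ i ∈ Finset.range k.length,
            dpow (gapCoeff c.blocksFun d (i + 1)) (exponents k i)) := by
    simp only [← sum_blockChain]
    rw [Finset.sum_comm, ← sum_composition]
    refine Finset.sum_congr rfl fun c _ => ?_
    have := sum_incTuples_gapCoeff qFrac c.blocksFun (fun j => c.blocks_pos (by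
      exact List.get_mem _ _)) (exponents k) N (fun _ => 1)
    simp only [one_mul, c.sum_blocksFun, c.ofFn_blocksFun] at this
    exact this.symm
  rw [h, gshSeries, PowerSeries.coeff_mk, Tsh, map_sum, map_sum, map_sum]
  refine Finset.sum_congr rfl fun c _ => ?_
  rw [PowerSeries.coeff_smul, HSeries, PowerSeries.coeff_mk, MvPowerSeries.coeff_smul, map_sum, map_sum,
    Finset.mul_sum]
  refine Finset.sum_congr rfl fun d _ => ?_
  rw [MvPowerSeries.coeff_smul, coeff_prod_exp, Finset.prod_range, mul_comm _ (algebraMap _ _ _),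
    PowerSeries.algebraMap_apply, Algebra.algebraMap_self, RingHom.id_apply, PowerSeries.coeff_C_mul,
    Finset.prod_smul, PowerSeries.coeff_smul]
  rw [← mul_assoc, mul_comm]
  congr 1
  refine Finset.prod_congr rfl fun i _ => ?_
  congr 1
  · rw [gapCoeff]
    refine Finset.sum_congr rfl fun j _ => ?_
    rw [suffixSum_blocksFun c (by omega), suffixSum_blocksFun c (by omega)]
  · simp [exponents]

end Series

/-! ### Characters of the shuffle algebra. -/

section Shuffle
set_option linter.unusedSectionVars false
variable {R : Type} [CommRing R] [Algebra ℚ R]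

/-- The sum of `h` over all ways to split a word into a prefix and a suffix. -/
def sumSplits (h : List (Fin 2) → List (Fin 2) → R) : List (Fin 2) → R
  | [] => h [] []
  | a :: w => h [] (a :: w) + sumSplits (fun p s => h (a :: p) s) w

/-- The convolution product of two functionals on words. -/
def convolution (f g : List (Fin 2) → R) (w : List (Fin 2)) : R := sumSplits (fun p s => f p * g s) w

theorem sumSplits_add (h h' : List (Fin 2) → List (Fin 2) → R) (w : List (Fin 2)) :
    sumSplits (fun p s => h p s + h' p s) w = sumSplits h w + sumSplits h' w := by
  induction w generalizing h h' with
  | nil => rfl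
  | cons a w ih => simp only [sumSplits, ih]; ring

theorem sumSplits_mul_left (c : R) (h : List (Fin 2) → List (Fin 2) → R) (w : List (Fin 2)) :
    sumSplits (fun p s => c * h p s) w = c * sumSplits h w := by
  induction w generalizing h with
  | nil => rfl
  | cons a w ih => simp only [sumSplits, ih]; ring

theorem linExt_word_mul {M : Type} [AddCommGroup M] [Module ℚ M] (f : List (Fin 2) → M) (a : Fin 2) (x : H) :
    linExt f (word [a] * x) = linExt (fun w => f (a :: w)) x := by
  have : linExt f ∘ₗ LinearMap.mulLeft ℚ (word [a]) = linExt (fun w => f (a :: w)) :=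
    NCPoly.hom_ext fun w => by simp [word_mul, linExt_word]
  exact LinearMap.congr_fun this x

theorem linExt_add {M : Type} [AddCommGroup M] [Module ℚ M] (f g : List (Fin 2) → M) (x : H) :
    linExt (fun w => f w + g w) x = linExt f x + linExt g x := by
  have : linExt (fun w => f w + g w) = linExt f + linExt g :=
    NCPoly.hom_ext fun w => by simp [linExt_word]
  exact LinearMap.congr_fun this x

theorem linExt_mul_left (c : R) (f : List (Fin 2) → R) (x : H) :
    linExt (fun w => c * f w) x = c * linExt f x := by
  have : linExt (fun w => c * f w) = LinearMap.mulLeft ℚ c ∘ₗ linExt f :=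
    NCPoly.hom_ext fun w => by simp [linExt_word]
  exact LinearMap.congr_fun this x

theorem shuffleWord_nil (w : List (Fin 2)) : shuffleWord w [] = word w := by
  cases w <;> simp [shuffleWord]

/-- Deconcatenation is multiplicative for the shuffle product: cutting a shuffle of u and v in two
amounts to cutting u and v and shuffling the pieces. -/
theorem linExt_convolution_shuffleWord (f g : List (Fin 2) → R) (u v : List (Fin 2)) :
    linExt (convolution f g) (shuffleWord u v)
      = sumSplits (fun u₁ u₂ => sumSplits (fun v₁ v₂ =>
          linExt f (shuffleWord u₁ v₁) * linExt g (shuffleWord u₂ v₂)) v) u := by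
  match u, v with
  | [], w => simp [shuffleWord, linExt_word, sumSplits, convolution]
  | a :: u, [] => simp [shuffleWord_nil, linExt_word, sumSplits, convolution]
  | a :: u, b :: v =>
    have ih1 := linExt_convolution_shuffleWord (fun w => f (a :: w)) g u (b :: v)
    have ih2 := linExt_convolution_shuffleWord (fun w => f (b :: w)) g (a :: u) v
    have hc (f : List (Fin 2) → R) (a : Fin 2) (x : H) : linExt (convolution f g) (word [a] * x)
        = f [] * linExt g (word [a] * x) + linExt (convolution (fun w => f (a :: w)) g) x := by
      rw [linExt_word_mul, linExt_word_mul, ← linExt_mul_left, ← linExt_add]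
      rfl
    conv_lhs => rw [shuffleWord, map_add, hc, hc, ih1, ih2]
    simp only [sumSplits, sumSplits_add, shuffleWord, linExt_word, map_add, linExt_word_mul, add_mul,
      shuffleWord_nil]
    ring
  termination_by u.length + v.length

/-- A functional on words is a character of the shuffle algebra. -/
def IsShuffleChar (f : List (Fin 2) → R) : Prop :=
  ∀ u v, linExt f (shuffleWord u v) = f u * f v

theorem IsShuffleChar.convolution {f g : List (Fin 2) → R} (hf : IsShuffleChar f)
    (hg : IsShuffleChar g) : IsShuffleChar (convolution f g) := by
  intro u v
  rw [linExt_convolution_shuffleWord]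
  simp only [hf _ _, hg _ _]
  have h (p s : List (Fin 2)) : sumSplits (fun v₁ v₂ => f p * f v₁ * (g s * g v₂)) v
      = sumSplits (fun v₁ v₂ => f v₁ * g v₂) v * (f p * g s) := by
    rw [mul_comm, ← sumSplits_mul_left]
    congr 1; ext; ring
  simp only [h, sumSplits_mul_left]
  rw [mul_comm]; rfl

/-- The functional `x ^ n ↦ h n` on the powers of a letter `x`, zero on other words. -/
def powerFunctional (x : Fin 2) (h : ℕ → R) : List (Fin 2) → R
  | [] => h 0
  | y :: w => if y = x then powerFunctional x (fun n => h (n + 1)) w else 0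

theorem powerFunctional_zero (x : Fin 2) (w : List (Fin 2)) :
    powerFunctional x (fun _ => (0 : R)) w = 0 := by
  induction w with
  | nil => rfl
  | cons y w ih => simp [powerFunctional, ih]

theorem linExt_zero (x : H) : linExt (fun _ => (0 : R)) x = 0 := by
  have := linExt_mul_left (0 : R) (fun _ => 0) x
  simpa using this

theorem powerFunctional_add (x : Fin 2) (h h' : ℕ → R) (w : List (Fin 2)) :
    powerFunctional x (fun n => h n + h' n) w = powerFunctional x h w + powerFunctional x h' w := by
  induction w generalizing h h' with
  | nil => rfl
  | cons y w ih => simp only [powerFunctional]; split_ifs <;> simp [ih]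

/-- Any other letter annihilates both sides, and x^m ш x^n is (m + n choose m) times x^{m+n}. -/
theorem linExt_powerFunctional_shuffleWord (x : Fin 2) (h : ℕ → R) (u v : List (Fin 2)) :
    linExt (powerFunctional x h) (shuffleWord u v)
      = powerFunctional x (fun m => powerFunctional x
          (fun n => ((m + n).choose m : R) * h (m + n)) v) u := by
  match u, v with
  | [], w => simp [shuffleWord, linExt_word, powerFunctional]
  | a :: u, [] => simp [shuffleWord_nil, linExt_word, powerFunctional]
  | a :: u, b :: v =>
    have ih1 := linExt_powerFunctional_shuffleWord x (fun n => h (n + 1)) u (b :: v)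
    have ih2 := linExt_powerFunctional_shuffleWord x (fun n => h (n + 1)) (a :: u) v
    have hc (a : Fin 2) (y : H) : linExt (powerFunctional x h) (word [a] * y)
        = if a = x then linExt (powerFunctional x (fun n => h (n + 1))) y else 0 := by
      rw [linExt_word_mul]
      split_ifs with ha
      · simp [powerFunctional, ha]
      · simp [powerFunctional, ha, linExt_zero]
    rw [shuffleWord, map_add, hc, hc, ih1, ih2]
    by_cases ha : a = x <;> by_cases hb : b = x <;>
      simp only [powerFunctional, ha, hb, if_true, if_false, powerFunctional_zero, add_zero]
    · rw [← powerFunctional_add]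
      congr 1; ext m
      rw [← powerFunctional_add]
      congr 1; ext n
      rw [show m + 1 + (n + 1) = m + n + 1 + 1 by ring, Nat.choose_succ_succ,
        show m + (n + 1) + 1 = m + n + 1 + 1 by ring, show m + 1 + n + 1 = m + n + 1 + 1 by ring,
        show m + (n + 1) = m + n + 1 by ring, show m + 1 + n = m + n + 1 by ring]
      push_cast
      ring
  termination_by u.length + v.length

theorem powerFunctional_mul_left (x : Fin 2) (c : R) (h : ℕ → R) (w : List (Fin 2)) :
    powerFunctional x (fun n => c * h n) w = c * powerFunctional x h w := by
  induction w generalizing h with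
  | nil => rfl
  | cons y w ih => simp only [powerFunctional]; split_ifs <;> simp [ih]

/-- The exponential `exp (c x)`, as a functional on words. -/
noncomputable def expFunctional (x : Fin 2) (c : R) : List (Fin 2) → R :=
  powerFunctional x fun n => ((n)! : ℚ)⁻¹ • c ^ n

theorem isShuffleChar_expFunctional (x : Fin 2) (c : R) : IsShuffleChar (expFunctional x c) := by
  intro u v
  rw [expFunctional, linExt_powerFunctional_shuffleWord]
  have h (m n : ℕ) : ((m + n).choose m : R) * (((m + n)! : ℚ)⁻¹ • c ^ (m + n))
      = (((m)! : ℚ)⁻¹ • c ^ m) * (((n)! : ℚ)⁻¹ • c ^ n) := by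
    rw [smul_mul_smul_comm, ← pow_add, ← nsmul_eq_mul, ← Nat.cast_smul_eq_nsmul ℚ, smul_smul]
    congr 1
    rw [Nat.cast_add_choose]
    have := Nat.factorial_ne_zero (m + n)
    field_simp
  simp only [h, powerFunctional_mul_left]
  rw [mul_comm, ← powerFunctional_mul_left]
  congr 1; ext; ring

/-- The ordered product of `exp (a_d e₁) exp (e₀)` for `d = M, …, 1`, as a functional on words. -/
noncomputable def pathFunctional (a : ℕ → R) : ℕ → List (Fin 2) → R
  | 0 => expFunctional 0 0
  | M + 1 => convolution (expFunctional 1 (a (M + 1))) (convolution (expFunctional 0 1)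
      (pathFunctional a M))

theorem isShuffleChar_pathFunctional (a : ℕ → R) (M : ℕ) : IsShuffleChar (pathFunctional a M) := by
  induction M with
  | zero => exact isShuffleChar_expFunctional _ _
  | succ M ih =>
    exact (isShuffleChar_expFunctional _ _).convolution ((isShuffleChar_expFunctional _ _).convolution ih)

theorem chain_zero (a : ℕ → R) (k : List ℕ+) (i : ℕ) :
    chain a k i 0 = if k = [] ∧ i = 0 then 1 else 0 := by
  induction k generalizing i with
  | nil => simp [chain]
  | cons k l ih => simp [chain, ih]

theorem convolution_powerFunctional_cons (x : Fin 2) (h : ℕ → R) (f : List (Fin 2) → R) (y : Fin 2)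
    (w : List (Fin 2)) : convolution (powerFunctional x h) f (y :: w)
      = h 0 * f (y :: w) + if y = x then convolution (powerFunctional x fun n => h (n + 1)) f w else 0 := by
  simp only [convolution, sumSplits, powerFunctional]
  split_ifs
  · rfl
  · simpa using sumSplits_mul_left (0 : R) (fun _ s => f s) w

theorem convolution_powerFunctional_encode (x : Fin 2) (hx : x = 0) (h : ℕ → R) (f : List (Fin 2) → R)
    (k : List ℕ+) : convolution (powerFunctional x h) f (encode k) = h 0 * f (encode k) := by
  cases k with
  | nil => rfl
  | cons k l => rw [encode, convolution_powerFunctional_cons, if_neg (by simp [hx]), add_zero]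

theorem convolution_powerFunctional_replicate (h : ℕ → R) (f : List (Fin 2) → R) (n : ℕ) (k : List ℕ+) :
    convolution (powerFunctional 0 h) f (List.replicate n 0 ++ encode k)
      = ∑ j ∈ Finset.range (n + 1), h j * f (List.replicate (n - j) 0 ++ encode k) := by
  induction n generalizing h with
  | zero => simp [convolution_powerFunctional_encode]
  | succ n ih =>
    rw [List.replicate_succ, List.cons_append, convolution_powerFunctional_cons, if_pos rfl, ih,
      Finset.sum_range_succ' _ (n + 1), add_comm]
    simp [List.replicate_succ]

theorem sum_inv_factorial_mul_dpow (x : ℚ) (n : ℕ) :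
    ∑ j ∈ Finset.range (n + 1), ((j)! : ℚ)⁻¹ * dpow x (n - j) = dpow (x + 1) n := by
  rw [dpow, add_comm x 1, add_pow, Finset.sum_div]
  refine Finset.sum_congr rfl fun j hj => ?_
  rw [Nat.cast_choose ℚ (Nat.lt_succ_iff.1 (Finset.mem_range.1 hj)), dpow]
  have := Nat.factorial_ne_zero n
  field_simp
  simp

/-- Reading the word from the left, e₁ is taken from the factor with index d. The following run of
e₀ comes from the d - d' factors exp(e₀) passed before the next e₁ at index d', and contributes a
divided power of d - d'. Several e₁ taken at the same index give a_d^n / n!. -/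
theorem pathFunctional_apply (a : ℕ → R) (M n : ℕ) (k : List ℕ+) :
    pathFunctional a M (List.replicate n 0 ++ encode k)
      = ∑ d ∈ Finset.range (M + 1), dpow ((M : ℚ) - d) n • chain a k 0 d := by
  induction M generalizing n k with
  | zero =>
    simp only [pathFunctional, expFunctional, zero_add, Finset.sum_range_one, chain_zero, Nat.cast_zero,
      sub_zero, dpow_zero_left]
    rcases n with _ | n
    · cases k <;> simp [encode, powerFunctional]
    · have h (w : List (Fin 2)) : powerFunctional 0 (fun n => ((n + 1)! : ℚ)⁻¹ • (0 : R) ^ (n + 1)) w = 0 := by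
        simp [powerFunctional_zero]
      simp [List.replicate_succ, powerFunctional, powerFunctional_zero]
  | succ M ih =>
    have hΨ (n : ℕ) (k : List ℕ+) : convolution (expFunctional 0 (1 : R)) (pathFunctional a M)
        (List.replicate n 0 ++ encode k)
        = ∑ d ∈ Finset.range (M + 1), dpow (((M + 1 : ℕ) : ℚ) - d) n • chain a k 0 d := by
      rw [expFunctional, convolution_powerFunctional_replicate]
      simp only [ih, Finset.mul_sum]
      rw [Finset.sum_comm]
      refine Finset.sum_congr rfl fun d _ => ?_
      rw [show ((M + 1 : ℕ) : ℚ) - d = (M - d) + 1 by push_cast; ring, ← sum_inv_factorial_mul_dpow,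
        Finset.sum_smul]
      refine Finset.sum_congr rfl fun j _ => ?_
      rw [one_pow, smul_mul_smul_comm, one_mul]
    rw [pathFunctional]
    set Ψ := convolution (expFunctional 0 (1 : R)) (pathFunctional a M) with hΨdef
    -- Here `i` letters e₁ have already been taken from the top exponential. The term with `Ψ` takes
    -- no more of them; the `chain` term takes at least one more.
    have hchain (k : List ℕ+) (i : ℕ) :
        convolution (powerFunctional 1 fun n => ((n + i)! : ℚ)⁻¹ • a (M + 1) ^ (n + i)) Ψ (encode k)
          = (((i)! : ℚ)⁻¹ • a (M + 1) ^ i) * Ψ (encode k) + chain a k i (M + 1) := by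
      induction k generalizing i with
      | nil => simp [encode, convolution, sumSplits, powerFunctional, chain]
      | cons k l ihk =>
        rw [encode, convolution_powerFunctional_cons, if_pos rfl, zero_add, chain, ← hΨ]
        congr 1
        have e (n : ℕ) : n + 1 + i = n + (i + 1) := by ring
        simp only [e]
        by_cases hk : k = 1
        · subst hk
          simpa using ihk (i + 1)
        · rw [if_neg hk, add_zero]
          obtain ⟨m, hm⟩ : ∃ m, (k : ℕ) - 1 = m + 1 := ⟨(k : ℕ) - 2, by
            have := k.pos
            have : (k : ℕ) ≠ 1 := fun h => hk (PNat.coe_eq_one_iff.1 h)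
            omega⟩
          rw [hm, List.replicate_succ, List.cons_append, convolution_powerFunctional_cons,
            if_neg (by simp), add_zero, zero_add]
    rw [Finset.sum_range_succ, sub_self, dpow_zero_left, ← hΨ]
    rcases n with _ | n
    · have := hchain k 0
      simpa [expFunctional] using this
    · rw [List.replicate_succ, List.cons_append, expFunctional, convolution_powerFunctional_cons,
        if_neg (by simp)]
      simp

theorem pathFunctional_encode (a : ℕ → R) (M : ℕ) (k : List ℕ+) :
    pathFunctional a M (encode k) = ∑ d ∈ Finset.range (M + 1), chain a k 0 d := by
  have := pathFunctional_apply a M 0 k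
  simpa [dpow] using this

end Shuffle

/-! ### Shuffle multiplicativity and the weight filtration. -/

section Series

theorem X_pow_dvd_qFrac (d : ℕ) : (PowerSeries.X : ℚ⟦X⟧) ^ d ∣ qFrac d := Dvd.intro _ rfl

theorem X_pow_dvd_chain (k : List ℕ+) (i d : ℕ) :
    (PowerSeries.X : ℚ⟦X⟧) ^ d ∣ chain qFrac k i d := by
  induction k generalizing i with
  | nil =>
    rw [chain]
    split_ifs with h
    · rw [h.2]; simp
    · exact dvd_zero _
  | cons k l ih =>
    rw [chain]
    refine dvd_add (Dvd.dvd.mul_right (dvd_smul_of_dvd _ (dvd_pow (X_pow_dvd_qFrac d) (by omega))) _) ?_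
    split_ifs
    · exact ih _
    · exact dvd_zero _

/-- A chain with largest index d is divisible by q^d, so a longer range of indices leaves the low
coefficients unchanged. -/
theorem coeff_gshSeries_of_le (k : List ℕ+) {n N : ℕ} (h : n ≤ N) :
    PowerSeries.coeff n (gshSeries k)
      = PowerSeries.coeff n (∑ d ∈ Finset.range (N + 1), chain qFrac k 0 d) := by
  rw [coeff_gshSeries, map_sum, map_sum]
  refine Finset.sum_subset (Finset.range_mono (by omega)) fun d _ hd => ?_
  have := (PowerSeries.X_pow_dvd_iff.1 (X_pow_dvd_chain k 0 d)) n (by simp at hd; omega)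
  exact this

theorem gsh_word (k : List ℕ+) : gsh (word k) = gshSeries k := linExt_word _ _

theorem coeff_gsh (x : H1) {n N : ℕ} (h : n ≤ N) : PowerSeries.coeff n (gsh x)
    = PowerSeries.coeff n (linExt (pathFunctional qFrac N) (H1.toH x)) := by
  have : PowerSeries.coeff n ∘ₗ gsh
      = PowerSeries.coeff n ∘ₗ (linExt (pathFunctional qFrac N) ∘ₗ H1.toH) :=
    NCPoly.hom_ext fun w => by
      simp [gsh_word, H1.toH_word, linExt_word, pathFunctional_encode, coeff_gshSeries_of_le w h]
  exact LinearMap.congr_fun this x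

/-- `𝔤^ш` is multiplicative for the shuffle product. -/
theorem gsh_shuffle (u v : List ℕ+) :
    gsh (H1.shuffle (word u) (word v)) = gsh (word u) * gsh (word v) := by
  ext n
  -- The character at level `n` computes all coefficients up to `n`, hence both factors in every
  -- term of the Cauchy product.
  rw [coeff_gsh _ le_rfl, H1.toH_shuffle, H1.toH_word, H1.toH_word, shuffle, linExt_word, linExt_word,
    isShuffleChar_pathFunctional qFrac n _ _, PowerSeries.coeff_mul, PowerSeries.coeff_mul]
  refine Finset.sum_congr rfl fun p hp => ?_
  have := Finset.HasAntidiagonal.mem_antidiagonal.1 hp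
  rw [coeff_gsh _ (show p.1 ≤ n by omega), coeff_gsh _ (show p.2 ≤ n by omega), H1.toH_word,
    H1.toH_word, linExt_word, linExt_word]

/-- The weight of a word in the letters `e_k`. -/
def weight (w : List ℕ+) : ℕ := (w.map (fun a : ℕ+ => (a : ℕ))).sum

theorem weight_cons (k : ℕ+) (w : List ℕ+) : weight (k :: w) = k + weight w := by simp [weight]

theorem gshSeries_mem {w : List ℕ+} {n : ℕ} (h : weight w ≤ n) : gshSeries w ∈ GshLE n :=
  Submodule.subset_span ⟨w, by simpa [weight, List.map_eq_flatMap] using h, rfl⟩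

theorem GshLE_mono {m n : ℕ} (h : m ≤ n) : GshLE m ≤ GshLE n := by
  apply Submodule.span_mono
  rintro f ⟨w, hw, rfl⟩
  exact ⟨w, hw.trans h, rfl⟩

theorem length_encode (w : List ℕ+) : (encode w).length = weight w := by
  induction w with
  | nil => rfl
  | cons k w ih =>
    have := k.pos
    simp only [encode, weight, List.length_cons, List.length_append, List.length_replicate,
      List.map_cons, List.sum_cons] at ih ⊢
    omega

theorem weight_decodeAux_le (w : List (Fin 2)) :
    (decodeAux w).1 + weight (decodeAux w).2 ≤ w.length := by
  induction w with
  | nil => simp [decodeAux, weight]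
  | cons a w ih =>
    by_cases ha : a = 0
    · rw [decodeAux, if_pos ha, List.length_cons]; simp only; omega
    · have h : decodeAux (a :: w) = (0, Nat.succPNat (decodeAux w).1 :: (decodeAux w).2) := by
        rw [decodeAux, if_neg ha]; rfl
      rw [h, weight_cons, Nat.succPNat_coe, List.length_cons]; omega

/-- The prefix `w` collects the letters already emitted by the shuffle recursion, so that `H1.ofH`
is only ever evaluated on complete words. Weight is bounded by length because decoding discards
leading e₀. -/
theorem gsh_ofH_shuffleWord_mem (u v w : List (Fin 2)) :
    gsh (H1.ofH (word w * shuffleWord u v)) ∈ GshLE (w.length + (u.length + v.length)) := by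
  have hword (w : List (Fin 2)) : gsh (H1.ofH (word w)) ∈ GshLE w.length := by
    rw [H1.ofH, linExt_word, gsh_word]
    refine gshSeries_mem (le_trans ?_ (weight_decodeAux_le w))
    rw [decode]; omega
  match u, v with
  | [], v => simpa [shuffleWord, word_mul] using hword (w ++ v)
  | a :: u, [] => simpa [shuffleWord, word_mul] using hword (w ++ a :: u)
  | a :: u, b :: v =>
    have h1 := gsh_ofH_shuffleWord_mem u (b :: v) (w ++ [a])
    have h2 := gsh_ofH_shuffleWord_mem (a :: u) v (w ++ [b])
    rw [shuffleWord, mul_add, ← mul_assoc, ← mul_assoc, word_mul, word_mul, map_add, map_add]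
    refine Submodule.add_mem _ (GshLE_mono ?_ h1) (GshLE_mono ?_ h2) <;> simp <;> omega
  termination_by u.length + v.length

theorem gsh_shuffle_mem (u v : List ℕ+) :
    gsh (H1.shuffle (word u) (word v)) ∈ GshLE (weight u + weight v) := by
  have := gsh_ofH_shuffleWord_mem (encode u) (encode v) []
  rw [H1.shuffle, H1.toH_word, H1.toH_word, shuffle, linExt_word, linExt_word]
  simpa [length_encode, show (word [] : H) = 1 from rfl] using this

end Series

/-! ### Nested sums over increasing indices. -/

section NestedSums
variable {R : Type} [CommRing R]

/-- The nested sum of `f₁(u₁) ⋯ f_r(u_r)` over `U ≤ u₁ < ⋯ < u_r < M`. -/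
def nestedSum : List (ℕ → R) → ℕ → ℕ → R
  | [], _, _ => 1
  | f :: l, U, M => ∑ u ∈ Finset.Ico U M, f u * nestedSum l (u + 1) M

theorem nestedSum_append_singleton (l : List (ℕ → R)) (f : ℕ → R) (U M : ℕ) :
    nestedSum (l ++ [f]) U M = ∑ t ∈ Finset.Ico U M, nestedSum l U t * f t := by
  induction l generalizing U with
  | nil => simp [nestedSum]
  | cons g l ih =>
    simp only [List.cons_append, nestedSum, ih, Finset.mul_sum, Finset.sum_mul]
    rw [Finset.sum_comm' (t' := Finset.Ico U M) (s' := fun t => Finset.Ico U t)]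
    · exact Finset.sum_congr rfl fun t _ => Finset.sum_congr rfl fun u _ => by ring
    · intro x y; simp only [Finset.mem_Ico]; omega

theorem sum_incTuples_prod {m : ℕ} (F : Fin m → ℕ → R) (M : ℕ) :
    ∑ d ∈ incTuples m M, ∏ j, F j (d j) = nestedSum (List.ofFn fun j u => F j (u + 1)) 0 M := by
  induction m generalizing M with
  | zero => simp [incTuples_zero, nestedSum]
  | succ m ih =>
    rw [sum_incTuples_succ, List.ofFn_succ', List.concat_eq_append, nestedSum_append_singleton,
      sum_Icc_one, Nat.Ico_zero_eq_range]
    refine Finset.sum_congr rfl fun t _ => ?_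
    simp only [Fin.prod_univ_castSucc, Fin.snoc_castSucc, Fin.snoc_last, ← Finset.sum_mul,
      Nat.add_sub_cancel]
    rw [ih]

theorem sum_Ico_mul_sum_Ico (F G : ℕ → R) (U M : ℕ) :
    (∑ u ∈ Finset.Ico U M, F u) * (∑ u ∈ Finset.Ico U M, G u)
      = ∑ u ∈ Finset.Ico U M, F u * (∑ v ∈ Finset.Ico (u + 1) M, G v)
        + ∑ u ∈ Finset.Ico U M, G u * (∑ v ∈ Finset.Ico (u + 1) M, F v)
        + ∑ u ∈ Finset.Ico U M, F u * G u := by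
  obtain ⟨n, hn⟩ : ∃ n, M - U = n := ⟨_, rfl⟩
  induction n generalizing U with
  | zero => simp [Finset.Ico_eq_empty_of_le (show M ≤ U by omega)]
  | succ n ih =>
    have h : U < M := by omega
    simp only [Finset.sum_eq_sum_Ico_succ_bot h]
    linear_combination ih (U + 1) (by omega)

end NestedSums

/-! ### Exchanging gaps with multiplicities. -/

section Transport
variable {R : Type} [CommRing R]

theorem geom_sum_mul_one_sub (x : R) (n : ℕ) :
    (∑ v ∈ Finset.range n, x ^ (v + 1)) * (1 - x) = x - x ^ (n + 1) := by
  induction n with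
  | zero => simp
  | succ n ih => rw [Finset.sum_range_succ, add_mul, ih]; ring

variable [Algebra ℚ R]

/-- Exchange of the two kinds of nested sums, one step at a time. -/
theorem sum_transport {q : R} {N : ℕ} (hq : ∀ m, N < m → q ^ m = 0) (U : ℕ) (h f : ℕ → ℚ)
    (D : ℕ → R) :
    ∑ d ∈ Finset.range (N + 1), q ^ (U * d) * ((∑ w ∈ Finset.range N, h w • q ^ (d * (w + 1)))
        * ∑ d' ∈ Finset.range d, f (d - d') • D d')
      = ∑ u ∈ Finset.Ico U N, h (u - U) • ((∑ v ∈ Finset.range N, f (v + 1) • q ^ ((u + 1) * (v + 1)))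
        * ∑ d' ∈ Finset.range (N + 1), q ^ ((u + 1) * d') * D d') := by
  -- With u = U + w and d = d' + v + 1 the exponent (U + w + 1)d splits as (u + 1)(v + 1) + (u +
  -- 1)d'. The gap d - d' thus becomes a multiplicity and u the new summation index; terms added or
  -- dropped to adjust the ranges vanish by nilpotency.
  set T : ℕ → ℕ → ℕ → R := fun w d d' =>
    (h w * f (d - d')) • (q ^ ((U + w + 1) * d) * D d') with hT
  have hT0 (w d d' : ℕ) (hN : N < (U + w + 1) * d) : T w d d' = 0 := by
    rw [hT]; simp [hq _ hN]
  have hl : ∑ d ∈ Finset.range (N + 1), q ^ (U * d) * ((∑ w ∈ Finset.range N, h w • q ^ (d * (w + 1)))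
        * ∑ d' ∈ Finset.range d, f (d - d') • D d')
      = ∑ w ∈ Finset.range N, ∑ d' ∈ Finset.range (N + 1), ∑ v ∈ Finset.range N,
        T w (d' + 1 + v) d' := by
    have e (d : ℕ) : q ^ (U * d) * ((∑ w ∈ Finset.range N, h w • q ^ (d * (w + 1)))
        * ∑ d' ∈ Finset.range d, f (d - d') • D d')
        = ∑ w ∈ Finset.range N, ∑ d' ∈ Finset.range d, T w d d' := by
      rw [Finset.sum_mul_sum, Finset.mul_sum]
      refine Finset.sum_congr rfl fun w _ => ?_
      rw [Finset.mul_sum]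
      refine Finset.sum_congr rfl fun d' _ => ?_
      simp only [hT, Algebra.smul_def, map_mul]
      ring
    simp only [e]
    rw [Finset.sum_comm]
    refine Finset.sum_congr rfl fun w _ => ?_
    rw [Finset.sum_comm' (t' := Finset.range (N + 1)) (s' := fun d' => Finset.Ico (d' + 1) (N + 1)) (by
      intro x y; simp only [Finset.mem_range, Finset.mem_Ico]; omega)]
    refine Finset.sum_congr rfl fun d' hd' => ?_
    rw [Finset.sum_Ico_eq_sum_range]
    refine Finset.sum_subset (Finset.range_mono (by omega)) fun v _ hv => hT0 _ _ _ ?_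
    have : N < d' + 1 + v := by simp at hv; omega
    nlinarith
  rw [hl, Finset.sum_Ico_eq_sum_range]
  symm
  rw [Finset.sum_subset (Finset.range_mono (show N - U ≤ N by omega))]
  · refine Finset.sum_congr rfl fun w _ => ?_
    rw [Finset.sum_mul_sum, Finset.sum_comm, Finset.smul_sum]
    refine Finset.sum_congr rfl fun d' _ => ?_
    rw [Finset.smul_sum]
    refine Finset.sum_congr rfl fun v _ => ?_
    simp only [hT, Nat.add_sub_cancel_left, show d' + 1 + v - d' = v + 1 by omega]
    simp only [Algebra.smul_def, map_mul]
    ring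
  · intro w _ hw
    have : N < U + w + 1 := by simp at hw; omega
    have e : ∑ v ∈ Finset.range N, f (v + 1) • q ^ ((U + w + 1) * (v + 1)) = 0 :=
      Finset.sum_eq_zero fun v _ => by rw [hq _ (by nlinarith), smul_zero]
    rw [e]; simp

theorem geom_sum_deriv_mul_one_sub (x : R) (n : ℕ) :
    (∑ v ∈ Finset.range n, (v : ℚ) • x ^ (v + 1)) * (1 - x)
      = x * (∑ v ∈ Finset.range n, x ^ (v + 1)) - (n : ℚ) • x ^ (n + 1) := by
  induction n with
  | zero => simp
  | succ n ih =>
    rw [Finset.sum_range_succ, add_mul, ih, Finset.sum_range_succ]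
    simp only [Algebra.smul_def, map_natCast]
    push_cast
    ring

end Transport

/-! ### Power series modulo powers of q. -/

section Truncation

/-- The ring of power series modulo `q ^ (N + 1)`. -/
def Trunc (N : ℕ) : Type := ℚ⟦X⟧ ⧸ Ideal.span {(PowerSeries.X : ℚ⟦X⟧) ^ (N + 1)}

noncomputable instance (N : ℕ) : CommRing (Trunc N) :=
  inferInstanceAs (CommRing (ℚ⟦X⟧ ⧸ Ideal.span {(PowerSeries.X : ℚ⟦X⟧) ^ (N + 1)}))

noncomputable instance (N : ℕ) : Algebra ℚ (Trunc N) :=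
  inferInstanceAs (Algebra ℚ (ℚ⟦X⟧ ⧸ Ideal.span {(PowerSeries.X : ℚ⟦X⟧) ^ (N + 1)}))

/-- Truncation of power series. -/
noncomputable def truncHom (N : ℕ) : ℚ⟦X⟧ →ₐ[ℚ] Trunc N :=
  Ideal.Quotient.mkₐ ℚ (Ideal.span {(PowerSeries.X : ℚ⟦X⟧) ^ (N + 1)})

/-- The class of the variable `q`. -/
noncomputable def qT (N : ℕ) : Trunc N := truncHom N PowerSeries.X

theorem truncHom_eq_iff {N : ℕ} {f g : ℚ⟦X⟧} : truncHom N f = truncHom N g ↔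
    ∀ n ≤ N, PowerSeries.coeff n f = PowerSeries.coeff n g := by
  refine (Ideal.Quotient.mk_eq_mk_iff_sub_mem f g).trans ?_
  rw [Ideal.mem_span_singleton, PowerSeries.X_pow_dvd_iff]
  simp only [map_sub, sub_eq_zero, Nat.lt_succ_iff]

theorem qT_pow_eq_zero {N m : ℕ} (h : N < m) : qT N ^ m = 0 := by
  rw [qT, ← map_pow, ← map_zero (truncHom N), truncHom_eq_iff]
  intro n hn
  rw [PowerSeries.coeff_X_pow, if_neg (by omega)]; simp

/-- The family of all truncations of a power series. -/
noncomputable def truncFamily : ℚ⟦X⟧ →ₐ[ℚ] (∀ N, Trunc N) := AlgHom.pi truncHom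

theorem truncFamily_apply (f : ℚ⟦X⟧) (N : ℕ) : truncFamily f N = truncHom N f := rfl

theorem truncFamily_injective : Function.Injective truncFamily := by
  intro f g h
  ext n
  exact truncHom_eq_iff.1 (congrFun h n) n le_rfl

theorem truncHom_qFrac_aux {N d : ℕ} (hd : 0 < d) : ∃ i : Trunc N,
    truncHom N (qFrac d) = qT N ^ d * i ∧ (1 - qT N ^ d) * i = 1 := by
  refine ⟨truncHom N ((1 - PowerSeries.X ^ d)⁻¹), ?_, ?_⟩
  · rw [qFrac, map_mul, map_pow]; rfl
  · have h1 : (1 - PowerSeries.X ^ d : ℚ⟦X⟧) * (1 - PowerSeries.X ^ d)⁻¹ = 1 :=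
      PowerSeries.mul_inv_cancel _ (by simp [hd.ne'])
    have h3 := congrArg (truncHom N) h1
    simp only [map_mul, map_sub, map_one, map_pow] at h3
    exact h3

theorem truncHom_qFrac {N d : ℕ} (hd : 0 < d) :
    truncHom N (qFrac d) = ∑ v ∈ Finset.range N, qT N ^ (d * (v + 1)) := by
  obtain ⟨i, h1, h2⟩ := truncHom_qFrac_aux (N := N) hd
  simp only [pow_mul]
  have h := geom_sum_mul_one_sub (qT N ^ d) N
  rw [← pow_mul _ d (N + 1), qT_pow_eq_zero (m := d * (N + 1)) (by nlinarith), sub_zero] at h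
  calc _ = _ := h1
    _ = _ := by nth_rewrite 1 [← h]; rw [mul_assoc, h2, mul_one]

theorem truncHom_qFrac_sq {N d : ℕ} (hd : 0 < d) :
    truncHom N (qFrac d) ^ 2 = ∑ v ∈ Finset.range N, (v : ℚ) • qT N ^ (d * (v + 1)) := by
  obtain ⟨i, h1, h2⟩ := truncHom_qFrac_aux (N := N) hd
  have h3 := truncHom_qFrac (N := N) hd
  simp only [pow_mul] at h3 ⊢
  have h := geom_sum_deriv_mul_one_sub (qT N ^ d) N
  rw [← pow_mul _ d (N + 1), qT_pow_eq_zero (m := d * (N + 1)) (by nlinarith), smul_zero, sub_zero,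
    ← h3] at h
  rw [pow_two]
  nth_rewrite 1 [h1]
  rw [mul_right_comm, ← h, mul_assoc, h2, mul_one]

end Truncation

/-! ### Shuffle q-series as nested sums of letters. -/

section Letters

/-- A letter: a function of the summation index `u + 1`, with values in truncated power series. -/
abbrev Letter : Type := ℕ → ∀ N, Trunc N

/-- The letter `u ↦ ∑_{v ≥ 1} c(v) q^{uv}`. -/
noncomputable def lambert (c : ℕ → ℚ) : Letter := fun u N =>
  ∑ v ∈ Finset.range N, c (v + 1) • qT N ^ ((u + 1) * (v + 1))

/-- The letter `u ↦ ∑_{v ≥ 1} v^{k-1} / (k-1)! q^{uv}`. -/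
noncomputable def letterA (k : ℕ+) : Letter := lambert fun v => dpow v (k - 1)

/-- The letter occurring at the non-final places of shuffle `q`-series. -/
noncomputable def letterB (k : ℕ+) : Letter := letterA k + (delta1 k * (1 / 2)) • (1 : Letter)

/-- Nested sums of letters over `U < u₁ < ⋯ < u_r`. -/
noncomputable def letterSum (l : List Letter) (U : ℕ) : ∀ N, Trunc N := fun N =>
  nestedSum (l.map fun f u => f u N) U N

theorem letterSum_nil (U : ℕ) : letterSum [] U = 1 := rfl

theorem letterSum_cons (f : Letter) (l : List Letter) (U N : ℕ) :
    letterSum (f :: l) U N = ∑ u ∈ Finset.Ico U N, f u N * letterSum l (u + 1) N := rfl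

/-- The letters whose nested sum is the shuffle `q`-series of a word. -/
noncomputable def letters : List ℕ+ → List Letter
  | [] => []
  | [k] => [letterA k]
  | k :: k' :: l => letterB k :: letters (k' :: l)

/-- No two consecutive letters of a word are equal to `e₁`. -/
def NoAdjacentOnes : List ℕ+ → Prop
  | [] => True
  | [_] => True
  | k :: k' :: l => (k ≠ 1 ∨ k' ≠ 1) ∧ NoAdjacentOnes (k' :: l)

theorem truncHom_chain_cons (N : ℕ) (k : ℕ+) (l : List ℕ+) (i d : ℕ) :
    truncHom N (chain qFrac (k :: l) i d)
      = (((i + 1)! : ℚ)⁻¹ • truncHom N (qFrac d) ^ (i + 1)) * ∑ d' ∈ Finset.range d,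
          dpow ((d - d' : ℕ) : ℚ) (k - 1) • truncHom N (chain qFrac l 0 d')
        + if k = 1 then truncHom N (chain qFrac l (i + 1) d) else 0 := by
  rw [chain, map_add, map_mul, map_smul, map_pow, map_sum, apply_ite (truncHom N), map_zero]
  congr 2
  refine Finset.sum_congr rfl fun d' hd' => ?_
  rw [map_smul, Nat.cast_sub (Finset.mem_range.1 hd').le]

/-- Partial shuffle sums, weighted by `q ^ (U d)` where `d` is the largest index. -/
noncomputable def topSum (l : List ℕ+) (U N : ℕ) : Trunc N :=
  ∑ d ∈ Finset.range (N + 1), qT N ^ (U * d) * truncHom N (chain qFrac l 0 d)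

theorem topSum_nil (U N : ℕ) : topSum [] U N = 1 := by
  rw [topSum, Finset.sum_range_succ', Finset.sum_eq_zero]
  · simp [chain]
  · intro d _; simp [chain]

theorem sum_transport_letterA (l : List ℕ+) (k : ℕ+) (U N : ℕ) :
    ∑ d ∈ Finset.range (N + 1), qT N ^ (U * d) * (truncHom N (qFrac d) * ∑ d' ∈ Finset.range d,
        dpow ((d - d' : ℕ) : ℚ) (k - 1) • truncHom N (chain qFrac l 0 d'))
      = ∑ u ∈ Finset.Ico U N, letterA k u N * topSum l (u + 1) N := by
  have h := sum_transport (q := qT N) (N := N) (fun m hm => qT_pow_eq_zero hm) U (fun _ => 1)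
    (fun n => dpow n (k - 1)) (fun d => truncHom N (chain qFrac l 0 d))
  simp only [one_smul] at h
  refine Eq.trans (Finset.sum_congr rfl fun d _ => ?_) h
  rcases Nat.eq_zero_or_pos d with rfl | hd
  · simp
  · rw [truncHom_qFrac hd]

/-- The coefficient of x^{v+1} in (x/(1 - x))^2 is v. After the exchange this weight is u' - U, the
number of free indices u with U ≤ u < u'. -/
theorem sum_transport_letterA_sq (l : List ℕ+) (k : ℕ+) (U N : ℕ) :
    ∑ d ∈ Finset.range (N + 1), qT N ^ (U * d) * (truncHom N (qFrac d) ^ 2 * ∑ d' ∈ Finset.range d,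
        dpow ((d - d' : ℕ) : ℚ) (k - 1) • truncHom N (chain qFrac l 0 d'))
      = ∑ u ∈ Finset.Ico U N, ∑ u' ∈ Finset.Ico (u + 1) N, letterA k u' N * topSum l (u' + 1) N := by
  have h := sum_transport (q := qT N) (N := N) (fun m hm => qT_pow_eq_zero hm) U (fun n => n)
    (fun n => dpow n (k - 1)) (fun d => truncHom N (chain qFrac l 0 d))
  refine Eq.trans (Finset.sum_congr rfl fun d _ => ?_) (h.trans ?_)
  · rcases Nat.eq_zero_or_pos d with rfl | hd
    · simp
    · rw [truncHom_qFrac_sq hd]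
  · rw [Finset.sum_comm' (t' := Finset.Ico U N) (s' := fun u' => Finset.Ico U u') (by
      intro x y; simp only [Finset.mem_Ico]; omega)]
    refine Finset.sum_congr rfl fun u _ => ?_
    rw [Finset.sum_const, Nat.card_Ico, Nat.cast_smul_eq_nsmul]
    rfl

theorem topSum_cons (k : ℕ+) (l : List ℕ+) (h : k ≠ 1 ∨ l = []) (U N : ℕ) :
    topSum (k :: l) U N = ∑ u ∈ Finset.Ico U N, letterA k u N * topSum l (u + 1) N := by
  rw [← sum_transport_letterA, topSum]
  refine Finset.sum_congr rfl fun d _ => ?_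
  -- A letter can share its index with a successor only if it is e₁ and a successor exists.
  have h0 : (if k = 1 then truncHom N (chain qFrac l (0 + 1) d) else 0) = 0 := by
    rcases h with h | rfl
    · rw [if_neg h]
    · simp [chain]
  rw [truncHom_chain_cons, h0]
  simp

/-- Either e₁ has an index of its own, which gives A₁, or it shares it with the next letter, with
weight a_d^2 / 2!. By `sum_transport_letterA_sq` the latter is a constant letter 1/2 in front. Since
k ≠ 1, no third letter can join. -/
theorem topSum_one_cons (k : ℕ+) (l : List ℕ+) (hk : k ≠ 1) (U N : ℕ) :
    topSum (1 :: k :: l) U N = ∑ u ∈ Finset.Ico U N, letterB 1 u N * topSum (k :: l) (u + 1) N := by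
  have h1 (u : ℕ) : letterB 1 u N = letterA 1 u N + algebraMap ℚ (Trunc N) (1 / 2) := by
    rw [letterB, delta1, if_pos rfl, one_mul, Algebra.algebraMap_eq_smul_one]; rfl
  simp only [h1, add_mul, Finset.sum_add_distrib]
  rw [← sum_transport_letterA, ← Finset.mul_sum]
  simp only [topSum_cons k l (Or.inl hk)]
  rw [← sum_transport_letterA_sq, Finset.mul_sum, ← Finset.sum_add_distrib, topSum]
  refine Finset.sum_congr rfl fun d _ => ?_
  rw [truncHom_chain_cons, truncHom_chain_cons, if_pos rfl, if_neg hk, add_zero, mul_add]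
  congr 1
  · simp
  · rw [Algebra.algebraMap_eq_smul_one, smul_one_mul, smul_mul_assoc, mul_smul_comm]
    norm_num [Nat.factorial]

theorem topSum_eq_letterSum (k : List ℕ+) (hk : NoAdjacentOnes k) (U N : ℕ) :
    topSum k U N = letterSum (letters k) U N := by
  match k with
  | [] => exact topSum_nil U N
  | [k] =>
    rw [topSum_cons k [] (Or.inr rfl), letters, letterSum_cons]
    simp only [topSum_nil]; rfl
  | k :: k' :: l =>
    have ih (U) := topSum_eq_letterSum (k' :: l) hk.2 U N
    rw [letters, letterSum_cons]
    simp only [← ih]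
    by_cases h : k = 1
    · subst h
      exact topSum_one_cons k' l (by simpa using hk.1) U N
    · rw [topSum_cons k _ (Or.inl h), letterB, delta1, if_neg h, zero_mul, zero_smul, add_zero]

theorem truncFamily_gshSeries {k : List ℕ+} (hk : NoAdjacentOnes k) :
    truncFamily (gshSeries k) = letterSum (letters k) 0 := by
  funext N
  rw [← topSum_eq_letterSum k hk, topSum, truncFamily_apply]
  simp only [zero_mul, pow_zero, one_mul]
  rw [← map_sum, truncHom_eq_iff]
  exact fun n hn => coeff_gshSeries_of_le k hn

end Letters

/-! ### Bi-brackets as nested sums. -/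

section BiBrackets

theorem truncHom_g {r : ℕ} (d : Fin r → ℕ) (k : Fin r → ℕ+) (N : ℕ) :
    truncHom N (g d k) = ∑ u ∈ incTuples r N,
      ∏ i, (dpow (u i) (d i) • ∑ v ∈ Finset.Icc 1 N, dpow v (k i - 1) • qT N ^ (u i * v)) := by
  have h : ∑ u ∈ incTuples r N,
      ∏ i, (dpow (u i) (d i) • ∑ v ∈ Finset.Icc 1 N, dpow v (k i - 1) • qT N ^ (u i * v))
      = truncHom N (∑ u ∈ incTuples r N, ∑ v ∈ Fintype.piFinset (fun _ : Fin r => Finset.Icc 1 N),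
        (∏ i, (dpow (u i) (d i) * dpow (v i) (k i - 1))) •
          (PowerSeries.X : ℚ⟦X⟧) ^ (∑ i, u i * v i)) := by
    rw [map_sum]
    refine Finset.sum_congr rfl fun u _ => ?_
    simp only [Finset.smul_sum]
    rw [Finset.prod_univ_sum, map_sum]
    refine Finset.sum_congr rfl fun v _ => ?_
    simp only [smul_smul]
    rw [Finset.prod_smul, map_smul, map_pow, Finset.prod_pow_eq_pow_sum]
    rfl
  rw [h, truncHom_eq_iff]
  intro n hn
  simp only [map_sum, PowerSeries.coeff_smul, PowerSeries.coeff_X_pow, g, PowerSeries.coeff_mk]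
  rw [← Finset.sum_product']
  simp only [smul_eq_mul, mul_ite, mul_one, mul_zero]
  rw [← Finset.sum_filter]
  -- Each product u_i v_i is at most n, so enlarging the ranges from `n` to `N` adds no solutions.
  have hb (u v : Fin r → ℕ) (hu : ∀ i, 1 ≤ u i ∧ 1 ≤ v i) (hs : ∑ i, u i * v i = n) (i : Fin r) :
      u i ≤ n ∧ v i ≤ n := by
    have : u i * v i ≤ n := hs ▸ Finset.single_le_sum (f := fun i => u i * v i)
      (fun _ _ => Nat.zero_le _) (Finset.mem_univ i)
    have := hu i
    constructor <;> nlinarith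
  refine Finset.sum_congr ?_ fun p _ => Finset.prod_congr rfl fun i _ => by simp [dpow]
  ext ⟨u, v⟩
  simp only [Finset.mem_filter, Finset.mem_product, Fintype.mem_piFinset, Finset.mem_Icc,
    mem_incTuples]
  constructor
  · rintro ⟨⟨h1, h2⟩, h3, h4⟩
    exact ⟨⟨⟨fun i => ⟨(h1 i).1, (h1 i).2.trans hn⟩, h3⟩, fun i => ⟨(h2 i).1, (h2 i).2.trans hn⟩⟩, h4.symm⟩
  · rintro ⟨⟨⟨h1, h3⟩, h2⟩, h4⟩
    have := hb u v (fun i => ⟨(h1 i).1, (h2 i).1⟩) h4.symm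
    exact ⟨⟨fun i => ⟨(h1 i).1, (this i).1⟩, fun i => ⟨(h2 i).1, (this i).2⟩⟩, h3, h4.symm⟩

/-- The letter `u ↦ u`. -/
noncomputable def indexLetter : Letter := fun u _ => (u : _) + 1

theorem truncFamily_g {r : ℕ} (d : Fin r → ℕ) (k : Fin r → ℕ+) :
    truncFamily (g d k)
      = letterSum (List.ofFn fun i => ((d i)! : ℚ)⁻¹ • (indexLetter ^ d i * letterA (k i))) 0 := by
  funext N
  rw [truncFamily_apply, truncHom_g, letterSum, List.map_ofFn]
  rw [sum_incTuples_prod (fun i u => dpow u (d i) •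
    ∑ v ∈ Finset.Icc 1 N, dpow v (k i - 1) • qT N ^ (u * v))]
  congr 2
  funext i u
  rw [sum_Icc_one]
  simp only [dpow, Function.comp_apply, Pi.smul_apply, Pi.mul_apply, Pi.pow_apply, indexLetter, letterA,
    lambert]
  rw [div_eq_inv_mul, mul_smul]
  congr 1
  rw [Algebra.smul_def, map_pow]
  simp

end BiBrackets

/-! ### Quasi-shuffle product, multilinearity and free indices. -/

section LetterSums

/-- The lists of letters occurring in the quasi-shuffle product of two lists of letters. -/
noncomputable def stuffleLists : List Letter → List Letter → List (List Letter)
  | [], m => [m]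
  | f :: l, [] => [f :: l]
  | f :: l, g :: m => (stuffleLists l (g :: m)).map (f :: ·) ++ (stuffleLists (f :: l) m).map (g :: ·)
      ++ (stuffleLists l m).map ((f * g) :: ·)
  termination_by u v => u.length + v.length

theorem sum_map_letterSum_cons (f : Letter) (L : List (List Letter)) (U N : ℕ) :
    ((L.map (f :: ·)).map fun l => letterSum l U N).sum
      = ∑ u ∈ Finset.Ico U N, f u N * (L.map fun l => letterSum l (u + 1) N).sum := by
  induction L with
  | nil => simp
  | cons l L ih =>
    simp only [List.map_cons, List.sum_cons, mul_add, Finset.sum_add_distrib, ih]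
    rfl

theorem letterSum_mul_apply (l m : List Letter) (U N : ℕ) : letterSum l U N * letterSum m U N
    = ((stuffleLists l m).map fun l => letterSum l U N).sum := by
  match l, m with
  | [], m => simp [stuffleLists, letterSum_nil]
  | f :: l, [] => simp [stuffleLists, letterSum_nil]
  | f :: l, g :: m =>
    have h1 (U) := letterSum_mul_apply l (g :: m) U N
    have h2 (U) := letterSum_mul_apply (f :: l) m U N
    have h3 (U) := letterSum_mul_apply l m U N
    rw [stuffleLists, List.map_append, List.map_append, List.sum_append, List.sum_append,
      sum_map_letterSum_cons, sum_map_letterSum_cons, sum_map_letterSum_cons, letterSum_cons,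
      letterSum_cons, sum_Ico_mul_sum_Ico]
    simp only [← letterSum_cons, ← h1, ← h2, ← h3]
    congr 1
    · congr 1
      · exact Finset.sum_congr rfl fun u _ => by ring
      · exact Finset.sum_congr rfl fun u _ => by ring
    · refine Finset.sum_congr rfl fun u _ => ?_
      rw [Pi.mul_apply, Pi.mul_apply]
      ring
  termination_by l.length + m.length

theorem letterSum_mul (l m : List Letter) (U : ℕ) : letterSum l U * letterSum m U
    = ((stuffleLists l m).map fun l => letterSum l U).sum := by
  funext N
  rw [Pi.mul_apply, letterSum_mul_apply]
  generalize stuffleLists l m = L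
  induction L with
  | nil => rfl
  | cons l L ih => simp [ih]

theorem letterSum_add (p s : List Letter) (f g : Letter) (U : ℕ) :
    letterSum (p ++ (f + g) :: s) U = letterSum (p ++ f :: s) U + letterSum (p ++ g :: s) U := by
  induction p generalizing U with
  | nil =>
    funext N
    simp only [List.nil_append, letterSum_cons, Pi.add_apply, add_mul, Finset.sum_add_distrib]
  | cons h p ih =>
    funext N
    simp only [List.cons_append, letterSum_cons h, Pi.add_apply, ih, mul_add, Finset.sum_add_distrib]

theorem letterSum_smul (p s : List Letter) (c : ℚ) (f : Letter) (U : ℕ) :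
    letterSum (p ++ (c • f) :: s) U = c • letterSum (p ++ f :: s) U := by
  induction p generalizing U with
  | nil =>
    funext N
    simp only [List.nil_append, letterSum_cons, Pi.smul_apply, smul_mul_assoc, Finset.smul_sum]
  | cons h p ih =>
    funext N
    simp only [List.cons_append, letterSum_cons h, Pi.smul_apply, ih, mul_smul_comm, Finset.smul_sum]

/-- Nested sums, as linear maps of one letter. -/
noncomputable def letterSumLin (p s : List Letter) (U : ℕ) : Letter →ₗ[ℚ] (∀ N, Trunc N) where
  toFun f := letterSum (p ++ f :: s) U
  map_add' f g := letterSum_add p s f g U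
  map_smul' c f := letterSum_smul p s c f U

/-- The free index u satisfies U ≤ u < u', so it has u' - U values. Positions are shifted by one,
`indexLetter` being u' + 1 at u'; hence the correction U + 1. -/
theorem letterSum_one_cons (f : Letter) (l : List Letter) (U : ℕ) :
    letterSum (1 :: f :: l) U
      = letterSum (indexLetter * f :: l) U - ((U : ℚ) + 1) • letterSum (f :: l) U := by
  funext N
  simp only [letterSum_cons, Pi.one_apply, one_mul, Pi.sub_apply, Pi.smul_apply, Pi.mul_apply]
  rw [Finset.sum_comm' (t' := Finset.Ico U N) (s' := fun u' => Finset.Ico U u') (by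
      intro x y; simp only [Finset.mem_Ico]; omega), Finset.smul_sum, ← Finset.sum_sub_distrib]
  refine Finset.sum_congr rfl fun u hu => ?_
  rw [Finset.sum_const, Nat.card_Ico, indexLetter, nsmul_eq_mul,
    Nat.cast_sub (Finset.mem_Ico.1 hu).1, Algebra.smul_def, map_add, map_natCast, map_one]
  ring

/-- Strictly between neighbours u < u' there are u' - u - 1 free values: the difference of the two
index factors, minus one copy of the sum without insertion. -/
theorem letterSum_insert_one (p : List Letter) (f g : Letter) (l : List Letter) (U : ℕ) :
    letterSum (p ++ f :: 1 :: g :: l) U = letterSum (p ++ f :: (indexLetter * g) :: l) U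
      - letterSum (p ++ (indexLetter * f) :: g :: l) U - letterSum (p ++ f :: g :: l) U := by
  induction p generalizing U with
  | nil =>
    funext N
    simp only [List.nil_append, letterSum_cons f, letterSum_cons (indexLetter * f), Pi.sub_apply,
      letterSum_one_cons, Pi.smul_apply, ← Finset.sum_sub_distrib]
    refine Finset.sum_congr rfl fun u hu => ?_
    rw [Pi.mul_apply, Pi.mul_apply, indexLetter, Algebra.smul_def]
    simp only [map_add, map_natCast, map_one, Nat.cast_add, Nat.cast_one]
    ring
  | cons h p ih =>
    funext N
    simp only [List.cons_append, letterSum_cons h, Pi.sub_apply, ih, mul_sub, Finset.sum_sub_distrib]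

end LetterSums

/-! ### Lambert series and the binomial basis. -/

section Merging

theorem lambert_add (c c' : ℕ → ℚ) : lambert (c + c') = lambert c + lambert c' := by
  funext u N
  simp only [lambert, Pi.add_apply, add_smul, Finset.sum_add_distrib]

theorem lambert_smul (t : ℚ) (c : ℕ → ℚ) : lambert (t • c) = t • lambert c := by
  funext u N
  simp only [lambert, Pi.smul_apply, smul_eq_mul, mul_smul, Finset.smul_sum]

/-- `lambert` as a linear map. -/
noncomputable def lambertLin : (ℕ → ℚ) →ₗ[ℚ] Letter where
  toFun := lambert
  map_add' := lambert_add
  map_smul' := lambert_smul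

/-- The Cauchy product of two sequences. -/
def cauchy (c c' : ℕ → ℚ) (n : ℕ) : ℚ := ∑ p ∈ Finset.HasAntidiagonal.antidiagonal n, c p.1 * c' p.2

theorem sum_range_mul_of_nilpotent {R : Type} [CommRing R] [Algebra ℚ R] {x : R} {N : ℕ}
    (hx : ∀ m, N < m → x ^ m = 0) (c c' : ℕ → ℚ) :
    (∑ v ∈ Finset.range (N + 1), c v • x ^ v) * (∑ v ∈ Finset.range (N + 1), c' v • x ^ v)
      = ∑ v ∈ Finset.range (N + 1), cauchy c c' v • x ^ v := by
  have h1 (v : ℕ) : cauchy c c' v • x ^ v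
      = ∑ k ∈ Finset.range (v + 1), (c k * c' (v - k)) • x ^ (k + (v - k)) := by
    rw [cauchy, Finset.Nat.sum_antidiagonal_eq_sum_range_succ (fun i j => c i * c' j), Finset.sum_smul]
    refine Finset.sum_congr rfl fun k hk => ?_
    rw [Nat.add_sub_cancel' (Nat.lt_succ_iff.1 (Finset.mem_range.1 hk))]
  simp only [h1]
  rw [Finset.sum_range_diag_flip (N + 1) fun i j => (c i * c' j) • x ^ (i + j), Finset.sum_mul_sum]
  refine Finset.sum_congr rfl fun i _ => ?_
  symm
  simp only [smul_mul_smul_comm, ← pow_add]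
  refine Finset.sum_subset (Finset.range_mono (by omega)) fun j _ hj => ?_
  rw [hx, smul_zero]
  simp at hj; omega

theorem lambert_eq_sum_range {c : ℕ → ℚ} (hc : c 0 = 0) (u N : ℕ) :
    lambert c u N = ∑ v ∈ Finset.range (N + 1), c v • (qT N ^ (u + 1)) ^ v := by
  rw [Finset.sum_range_succ', hc, zero_smul, add_zero, lambert]
  simp only [pow_mul]

theorem lambert_mul {c c' : ℕ → ℚ} (hc : c 0 = 0) (hc' : c' 0 = 0) :
    lambert c * lambert c' = lambert (cauchy c c') := by
  funext u N
  rw [Pi.mul_apply, Pi.mul_apply, lambert_eq_sum_range hc, lambert_eq_sum_range hc',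
    lambert_eq_sum_range (by simp [cauchy, hc]), sum_range_mul_of_nilpotent]
  intro m hm
  rw [← pow_mul]
  exact qT_pow_eq_zero (by nlinarith)

/-- The sequence of binomial coefficients `n.choose j`. -/
def binom (j n : ℕ) : ℚ := n.choose j

/-- The sequence `n ^ j / j!`. -/
noncomputable def monom (j n : ℕ) : ℚ := dpow n j

/-- In the binomial basis the Cauchy product is a single binomial coefficient, by Pascal's rule.
Products of letters are therefore computed there and transferred to monomials. -/
theorem binom_cauchy (i j n : ℕ) : cauchy (binom i) (binom j) n = (n + 1).choose (i + j + 1) := by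
  induction n generalizing i with
  | zero =>
    cases i <;> cases j <;> simp [cauchy, binom, Nat.choose_eq_zero_of_lt]
  | succ n ih =>
    rw [cauchy, Finset.Nat.sum_antidiagonal_succ]
    cases i with
    | zero =>
      have := ih 0
      simp only [cauchy, binom, Nat.choose_zero_right, Nat.cast_one, one_mul, zero_add] at this ⊢
      rw [this, Nat.choose_succ_succ (n + 1) j]
      push_cast
      ring
    | succ i =>
      simp only [binom, Nat.choose_zero_succ, Nat.choose_succ_succ _ i, Nat.cast_zero, zero_mul, zero_add,
        Nat.cast_add, add_mul, Finset.sum_add_distrib]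
      have h1 := ih i
      have h2 := ih (i + 1)
      simp only [cauchy, binom] at h1 h2
      rw [h1, h2, show i + 1 + j + 1 = (i + j + 1) + 1 by ring, Nat.choose_succ_succ (n + 1)]
      push_cast
      ring

/-- The span of the monomials `n ^ j`, `1 ≤ j ≤ m`. -/
def monomSpan (m : ℕ) : Submodule ℚ (ℕ → ℚ) := Submodule.span ℚ {c | ∃ j, 1 ≤ j ∧ j ≤ m ∧ c = monom j}

theorem monom_mem {j m : ℕ} (h1 : 1 ≤ j) (h2 : j ≤ m) : monom j ∈ monomSpan m :=
  Submodule.subset_span ⟨j, h1, h2, rfl⟩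

theorem monomSpan_mono {m n : ℕ} (h : m ≤ n) : monomSpan m ≤ monomSpan n :=
  Submodule.span_mono fun _ ⟨j, h1, h2, h3⟩ => ⟨j, h1, h2.trans h, h3⟩

theorem id_mul_monom (j : ℕ) : (fun n : ℕ => (n : ℚ)) * monom j = ((j : ℚ) + 1) • monom (j + 1) := by
  funext n
  simp only [Pi.mul_apply, Pi.smul_apply, monom, dpow, Nat.factorial_succ, pow_succ, smul_eq_mul]
  have := Nat.factorial_ne_zero j
  push_cast
  field_simp

theorem id_mul_mem {m : ℕ} {c : ℕ → ℚ} (hc : c ∈ monomSpan m) :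
    (fun n : ℕ => (n : ℚ)) * c ∈ monomSpan (m + 1) := by
  induction hc using Submodule.span_induction with
  | mem c h =>
    obtain ⟨j, h1, h2, rfl⟩ := h
    rw [id_mul_monom]
    exact Submodule.smul_mem _ _ (monom_mem (by omega) (by omega))
  | zero => rw [mul_zero]; exact Submodule.zero_mem _
  | add x y _ _ hx hy => rw [mul_add]; exact Submodule.add_mem _ hx hy
  | smul t x _ hx => rw [mul_smul_comm]; exact Submodule.smul_mem _ _ hx

/-- By induction from (m + 2)(n choose m + 2) = (n - m - 1)(n choose m + 1). No constant term
appears, which later keeps A₁ out of the lower letters. -/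
theorem binom_sub_monom_mem (m : ℕ) : binom (m + 1) - monom (m + 1) ∈ monomSpan m := by
  induction m with
  | zero =>
    have : binom (0 + 1) - monom (0 + 1) = 0 := by
      funext n; simp [binom, monom, dpow]
    rw [this]; exact Submodule.zero_mem _
  | succ m ih =>
    have h : binom (m + 2) - monom (m + 2) = ((m : ℚ) + 2)⁻¹ • ((fun n : ℕ => (n : ℚ)) *
        (binom (m + 1) - monom (m + 1)) - ((m : ℚ) + 1) • (binom (m + 1) - monom (m + 1))
        - ((m : ℚ) + 1) • monom (m + 1)) := by
      rw [mul_sub, id_mul_monom]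
      funext n
      have h1 : (binom (m + 2) n) * ((m : ℚ) + 2) = binom (m + 1) n * ((n : ℚ) - (m + 1)) := by
        have := Nat.choose_succ_right_eq n (m + 1)
        rcases le_or_gt (m + 1) n with hn | hn
        · have := congrArg (Nat.cast : ℕ → ℚ) this
          push_cast [Nat.cast_sub hn] at this
          rw [binom, binom, ← this]; ring
        · simp [binom, Nat.choose_eq_zero_of_lt hn, Nat.choose_eq_zero_of_lt (show n < m + 2 by omega)]
      have h2 : (m : ℚ) + 2 ≠ 0 := by positivity
      simp only [Pi.sub_apply, Pi.smul_apply, Pi.mul_apply, smul_eq_mul]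
      rw [eq_inv_mul_iff_mul_eq₀ h2]
      push_cast
      linear_combination h1
    rw [h]
    refine Submodule.smul_mem _ _ (Submodule.sub_mem _ (Submodule.sub_mem _ (id_mul_mem ih) ?_) ?_)
    · exact Submodule.smul_mem _ _ (monomSpan_mono (by omega) ih)
    · exact Submodule.smul_mem _ _ (monom_mem (by omega) (by omega))

theorem binom_mem {j m : ℕ} (h1 : 1 ≤ j) (h2 : j ≤ m) : binom j ∈ monomSpan m := by
  obtain ⟨i, rfl⟩ : ∃ i, j = i + 1 := ⟨j - 1, by omega⟩
  have := Submodule.add_mem _ (monomSpan_mono (by omega) (binom_sub_monom_mem i)) (monom_mem h1 h2)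
  simpa using this

theorem monomSpan_le (m : ℕ) :
    monomSpan m ≤ Submodule.span ℚ {c | ∃ j, 1 ≤ j ∧ j ≤ m ∧ c = binom j} := by
  induction m with
  | zero =>
    apply Submodule.span_le.2
    rintro c ⟨j, h1, h2, rfl⟩; omega
  | succ m ih =>
    have hm : Submodule.span ℚ {c | ∃ j, 1 ≤ j ∧ j ≤ m ∧ c = binom j}
        ≤ Submodule.span ℚ {c | ∃ j, 1 ≤ j ∧ j ≤ m + 1 ∧ c = binom j} :=
      Submodule.span_mono fun _ ⟨j, h1, h2, h3⟩ => ⟨j, h1, by omega, h3⟩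
    apply Submodule.span_le.2
    rintro c ⟨j, h1, h2, rfl⟩
    rcases Nat.lt_or_ge j (m + 1) with h | h
    · exact hm (ih (monom_mem h1 (by omega)))
    · obtain rfl : j = m + 1 := by omega
      have h3 : binom (m + 1) ∈ Submodule.span ℚ {c | ∃ j, 1 ≤ j ∧ j ≤ m + 1 ∧ c = binom j} :=
        Submodule.subset_span ⟨m + 1, h1, le_rfl, rfl⟩
      have := Submodule.sub_mem _ h3 (hm (ih (binom_sub_monom_mem m)))
      simpa using this

end Merging

/-! ### Products of two letters modulo lower letters. -/

section Merging

/-- The Cauchy product as a bilinear map. -/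
noncomputable def cauchyLin : (ℕ → ℚ) →ₗ[ℚ] (ℕ → ℚ) →ₗ[ℚ] (ℕ → ℚ) :=
  LinearMap.mk₂ ℚ cauchy
    (fun a b c => by funext n; simp [cauchy, add_mul, Finset.sum_add_distrib])
    (fun t a b => by funext n; simp [cauchy, mul_assoc, Finset.mul_sum])
    (fun a b c => by funext n; simp [cauchy, mul_add, Finset.sum_add_distrib])
    (fun t a b => by
      funext n
      simp only [cauchy, Pi.smul_apply, smul_eq_mul, Finset.mul_sum]
      exact Finset.sum_congr rfl fun _ _ => by ring)

theorem cauchyLin_apply (c c' : ℕ → ℚ) : cauchyLin c c' = cauchy c c' := rfl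

theorem cauchyLin_binom (i j : ℕ) :
    cauchyLin (binom i) (binom j) = binom (i + j) + binom (i + j + 1) := by
  funext n
  rw [cauchyLin_apply, binom_cauchy, Nat.choose_succ_succ]
  simp [binom]

theorem cauchyLin_mem {i j : ℕ} {x y : ℕ → ℚ} (hx : x ∈ monomSpan i) (hy : y ∈ monomSpan j) :
    cauchyLin x y ∈ monomSpan (i + j + 1) := by
  have h : monomSpan i ≤ (⨅ y : monomSpan j, (monomSpan (i + j + 1)).comap (cauchyLin.flip y)) := by
    refine (monomSpan_le i).trans (Submodule.span_le.2 ?_)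
    rintro _ ⟨i', h1, h2, rfl⟩
    rw [SetLike.mem_coe, Submodule.mem_iInf]
    rintro ⟨y, hy⟩
    have h' : monomSpan j ≤ (monomSpan (i + j + 1)).comap (cauchyLin (binom i')) := by
      refine (monomSpan_le j).trans (Submodule.span_le.2 ?_)
      rintro _ ⟨j', h3, h4, rfl⟩
      rw [SetLike.mem_coe, Submodule.mem_comap, cauchyLin_binom]
      exact Submodule.add_mem _ (binom_mem (by omega) (by omega)) (binom_mem (by omega) (by omega))
    exact h' hy
  have := h hx
  rw [Submodule.mem_iInf] at this
  exact this ⟨y, hy⟩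

theorem cauchyLin_monom_sub_mem (i j : ℕ) :
    cauchyLin (monom (i + 1)) (monom (j + 1)) - monom (i + j + 3) ∈ monomSpan (i + j + 2) := by
  have h : cauchyLin (monom (i + 1)) (monom (j + 1)) - monom (i + j + 3)
      = binom (i + j + 2) + (binom (i + j + 2 + 1) - monom (i + j + 2 + 1))
        - cauchyLin (binom (i + 1) - monom (i + 1)) (binom (j + 1))
        - cauchyLin (monom (i + 1)) (binom (j + 1) - monom (j + 1)) := by
    have := cauchyLin_binom (i + 1) (j + 1)
    rw [show i + 1 + (j + 1) = i + j + 2 by ring] at this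
    simp only [map_sub, LinearMap.sub_apply, this]
    abel
  rw [h]
  refine Submodule.sub_mem _ (Submodule.sub_mem _ (Submodule.add_mem _
    (binom_mem (by omega) (by omega)) (binom_sub_monom_mem _)) ?_) ?_
  · have := cauchyLin_mem (binom_sub_monom_mem i) (binom_mem (j := j + 1) (by omega) le_rfl)
    rwa [show i + (j + 1) + 1 = i + j + 2 by ring] at this
  · have := cauchyLin_mem (monom_mem (j := i + 1) (by omega) le_rfl) (binom_sub_monom_mem j)
    rwa [show i + 1 + j + 1 = i + j + 2 by ring] at this

/-- The indicator of the positive integers. -/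
def posIndicator (n : ℕ) : ℚ := if n = 0 then 0 else 1

/-- The letter A₁ needs separate treatment: the constant sequence 1 does not vanish at 0, so its
product rule has to use the indicator of n > 0. That indicator is `binom 0` minus the unit of the
Cauchy product, which cancels one of the two terms of `cauchyLin_binom`. -/
theorem cauchyLin_posIndicator_binom (j : ℕ) : cauchyLin posIndicator (binom j) = binom (j + 1) := by
  have h : posIndicator = binom 0 - Pi.single 0 1 := by
    funext n; cases n <;> simp [posIndicator, binom]
  have h2 : cauchyLin (Pi.single 0 1) (binom j) = binom j := by
    funext n
    rw [cauchyLin_apply, cauchy, Finset.sum_eq_single (0, n)]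
    · simp
    · rintro ⟨a, b⟩ hab hne
      have : a ≠ 0 := by
        rintro rfl
        simp at hab
        exact hne (by rw [hab])
      simp [this]
    · simp
  rw [h, map_sub, LinearMap.sub_apply, h2, cauchyLin_binom]
  simp

theorem cauchyLin_posIndicator_mem {m : ℕ} {y : ℕ → ℚ} (hy : y ∈ monomSpan m) :
    cauchyLin posIndicator y ∈ monomSpan (m + 1) := by
  have h' : monomSpan m ≤ (monomSpan (m + 1)).comap (cauchyLin posIndicator) := by
    refine (monomSpan_le m).trans (Submodule.span_le.2 ?_)
    rintro _ ⟨j', h3, h4, rfl⟩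
    rw [SetLike.mem_coe, Submodule.mem_comap, cauchyLin_posIndicator_binom]
    exact binom_mem (by omega) (by omega)
  exact h' hy

theorem cauchyLin_posIndicator_monom_sub_mem (j : ℕ) :
    cauchyLin posIndicator (monom (j + 1)) - monom (j + 2) ∈ monomSpan (j + 1) := by
  have h : cauchyLin posIndicator (monom (j + 1)) - monom (j + 2)
      = (binom (j + 1 + 1) - monom (j + 1 + 1))
        - cauchyLin posIndicator (binom (j + 1) - monom (j + 1)) := by
    rw [map_sub, cauchyLin_posIndicator_binom]
    abel
  rw [h]
  exact Submodule.sub_mem _ (binom_sub_monom_mem _) (cauchyLin_posIndicator_mem (binom_sub_monom_mem j))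

/-- The span of the letters `A_k`, `2 ≤ k ≤ n`. -/
noncomputable def lowLetters (n : ℕ) : Submodule ℚ Letter :=
  Submodule.span ℚ {f | ∃ k : ℕ+, k ≠ 1 ∧ (k : ℕ) ≤ n ∧ f = letterA k}

theorem letterA_mem {k : ℕ+} {n : ℕ} (h : k ≠ 1) (hn : (k : ℕ) ≤ n) : letterA k ∈ lowLetters n :=
  Submodule.subset_span ⟨k, h, hn, rfl⟩

theorem lambertLin_mem {m n : ℕ} (h : m + 1 ≤ n) {c : ℕ → ℚ} (hc : c ∈ monomSpan m) :
    lambertLin c ∈ lowLetters n := by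
  have h' : monomSpan m ≤ (lowLetters n).comap lambertLin := by
    refine Submodule.span_le.2 ?_
    rintro _ ⟨j, h1, h2, rfl⟩
    refine letterA_mem (k := j.succPNat) ?_ (by simp; omega)
    intro e
    have := congrArg PNat.val e
    simp at this
    omega
  exact h' hc

theorem letterA_eq_lambertLin (k : ℕ+) : letterA k = lambertLin (monom (k - 1)) := rfl

theorem letterA_one : letterA 1 = lambert posIndicator := by
  funext u N
  simp [letterA, lambert, posIndicator, dpow]

theorem exists_eq_add_two {k : ℕ+} (h : k ≠ 1) : ∃ i, (k : ℕ) = i + 2 :=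
  ⟨(k : ℕ) - 2, by
    have := k.pos
    have : (k : ℕ) ≠ 1 := fun e => h (PNat.coe_eq_one_iff.1 e)
    omega⟩

theorem letterA_one_mul_sub_mem {b : ℕ+} (hb : b ≠ 1) :
    letterA 1 * letterA b - letterA (1 + b) ∈ lowLetters b := by
  obtain ⟨j, hj⟩ := exists_eq_add_two hb
  have e1 : letterA b = lambert (monom (j + 1)) := by
    rw [letterA_eq_lambertLin, hj]; rfl
  have e2 : letterA (1 + b) = lambert (monom (j + 2)) := by
    rw [letterA_eq_lambertLin, PNat.add_coe, hj, show ((1 : ℕ+) : ℕ) + (j + 2) - 1 = j + 2 by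
      rw [PNat.one_coe]; omega]
    rfl
  rw [e1, e2, letterA_one, lambert_mul rfl (by simp [monom, dpow])]
  have := lambertLin_mem (n := b) (by omega) (cauchyLin_posIndicator_monom_sub_mem j)
  rwa [map_sub] at this

theorem letterA_mul_sub_mem {a b : ℕ+} (h : a ≠ 1 ∨ b ≠ 1) :
    letterA a * letterA b - letterA (a + b) ∈ lowLetters (a + b - 1) := by
  by_cases ha : a = 1
  · subst ha
    have := letterA_one_mul_sub_mem (show b ≠ 1 by simpa using h)
    rwa [PNat.one_coe, Nat.add_sub_cancel_left]
  · by_cases hb : b = 1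
    · subst hb
      have := letterA_one_mul_sub_mem ha
      rwa [PNat.one_coe, Nat.add_sub_cancel, mul_comm, add_comm]
    · obtain ⟨i, hi⟩ := exists_eq_add_two ha
      obtain ⟨j, hj⟩ := exists_eq_add_two hb
      have e1 : letterA a = lambert (monom (i + 1)) := by
        rw [letterA_eq_lambertLin, hi]; rfl
      have e2 : letterA b = lambert (monom (j + 1)) := by
        rw [letterA_eq_lambertLin, hj]; rfl
      have e3 : letterA (a + b) = lambert (monom (i + j + 3)) := by
        rw [letterA_eq_lambertLin, PNat.add_coe, hi, hj, show i + 2 + (j + 2) - 1 = i + j + 3 by omega]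
        rfl
      rw [e1, e2, e3, lambert_mul (by simp [monom, dpow]) (by simp [monom, dpow])]
      have := lambertLin_mem (n := a + b - 1) (by omega) (cauchyLin_monom_sub_mem i j)
      rwa [map_sub] at this

/-- Up to lower letters, the product of two letters is the letter of the sum of their indices. -/
theorem letter_merge_mem {a b : ℕ+} (h : a ≠ 1 ∨ b ≠ 1) (s t : ℚ) :
    letterA (a + b) - (letterA a + (delta1 a * s) • (1 : Letter))
      * (letterA b + (delta1 b * t) • (1 : Letter)) ∈ lowLetters (a + b - 1) := by
  have h0 : delta1 a * delta1 b = 0 := by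
    rcases h with h | h <;> simp [delta1, h]
  have h1 : letterA (a + b) - (letterA a + (delta1 a * s) • (1 : Letter))
      * (letterA b + (delta1 b * t) • (1 : Letter))
      = -(letterA a * letterA b - letterA (a + b)) - (delta1 b * t) • letterA a
        - (delta1 a * s) • letterA b := by
    have h2 : ((delta1 a * s) • (1 : Letter)) * ((delta1 b * t) • (1 : Letter)) = 0 := by
      rw [smul_mul_smul_comm, show delta1 a * s * (delta1 b * t) = (delta1 a * delta1 b) * (s * t) by ring,
        h0, zero_mul, zero_smul]
    rw [add_mul, mul_add, mul_add, h2, mul_smul_comm, mul_one, smul_mul_assoc, one_mul]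
    abel
  rw [h1]
  -- The shift of the second letter is present only for b = 1; then a = a + b - 1 is just within the
  -- bound, and a ≠ 1.
  have hc (a b : ℕ+) (h : a ≠ 1 ∨ b ≠ 1) (t : ℚ) : (delta1 b * t) • letterA a ∈ lowLetters (a + b - 1) := by
    by_cases hb : b = 1
    · have := b.pos
      exact Submodule.smul_mem _ _ (letterA_mem (by simpa [hb] using h) (by omega))
    · rw [delta1, if_neg hb, zero_mul, zero_smul]; exact Submodule.zero_mem _
  refine Submodule.sub_mem _ (Submodule.sub_mem _ (Submodule.neg_mem _ (letterA_mul_sub_mem h))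
    (hc a b h t)) ?_
  have := hc b a h.symm s
  rwa [Nat.add_comm (b : ℕ)] at this

theorem letterB_eq (k : ℕ+) : letterB k = letterA k + (delta1 k * (1 / 2)) • (1 : Letter) := rfl

theorem letterB_of_ne_one {k : ℕ+} (h : k ≠ 1) : letterB k = letterA k := by
  rw [letterB, delta1, if_neg h, zero_mul, zero_smul, add_zero]

theorem letterA_eq (k : ℕ+) : letterA k = letterA k + (delta1 k * 0) • (1 : Letter) := by
  rw [mul_zero, zero_smul, add_zero]

theorem merge_AA_mem {a b : ℕ+} (h : a ≠ 1 ∨ b ≠ 1) :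
    letterA (a + b) - letterA a * letterA b ∈ lowLetters (a + b - 1) := by
  have := letter_merge_mem h 0 0
  simpa only [← letterA_eq] using this

theorem merge_AB_mem {a b : ℕ+} (h : a ≠ 1 ∨ b ≠ 1) :
    letterA (a + b) - letterA a * letterB b ∈ lowLetters (a + b - 1) := by
  have := letter_merge_mem h 0 (1 / 2)
  simpa only [← letterA_eq, ← letterB_eq] using this

theorem merge_BA_mem {a b : ℕ+} (h : a ≠ 1 ∨ b ≠ 1) :
    letterA (a + b) - letterB a * letterA b ∈ lowLetters (a + b - 1) := by
  have := letter_merge_mem h (1 / 2) 0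
  simpa only [← letterA_eq, ← letterB_eq] using this

theorem merge_BB_mem {a b : ℕ+} (h : a ≠ 1 ∨ b ≠ 1) :
    letterA (a + b) - letterB a * letterB b ∈ lowLetters (a + b - 1) :=
  letter_merge_mem h (1 / 2) (1 / 2)

end Merging

/-! ### Weight-bounded spans in terms of nested sums. -/

section Membership

/-- The image of `𝒢^ш_{≤ n}` under truncation. -/
noncomputable def GshT (n : ℕ) : Submodule ℚ (∀ N, Trunc N) := (GshLE n).map truncFamily.toLinearMap

theorem truncFamily_mem {f : ℚ⟦X⟧} {n : ℕ} : truncFamily f ∈ GshT n ↔ f ∈ GshLE n := by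
  constructor
  · rintro ⟨g, hg, h⟩
    rwa [← truncFamily_injective h]
  · exact fun h => ⟨f, h, rfl⟩

theorem GshT_mono {m n : ℕ} (h : m ≤ n) : GshT m ≤ GshT n := Submodule.map_mono (GshLE_mono h)

theorem letterSum_letters_mem {w : List ℕ+} (hw : NoAdjacentOnes w) {n : ℕ} (h : weight w ≤ n) :
    letterSum (letters w) 0 ∈ GshT n := by
  rw [← truncFamily_gshSeries hw, truncFamily_mem]
  exact gshSeries_mem h

theorem letterSum_mem_of_lowLetters {p s : List Letter} {m n : ℕ}
    (h : ∀ k : ℕ+, k ≠ 1 → (k : ℕ) ≤ m → letterSum (p ++ letterA k :: s) 0 ∈ GshT n) {f : Letter}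
    (hf : f ∈ lowLetters m) : letterSum (p ++ f :: s) 0 ∈ GshT n := by
  have h' : lowLetters m ≤ (GshT n).comap (letterSumLin p s 0) := by
    refine Submodule.span_le.2 ?_
    rintro _ ⟨k, h1, h2, rfl⟩
    exact h k h1 h2
  exact h' hf

theorem letterSum_sub (p s : List Letter) (f g : Letter) (U : ℕ) :
    letterSum (p ++ (f - g) :: s) U = letterSum (p ++ f :: s) U - letterSum (p ++ g :: s) U :=
  (letterSumLin p s U).map_sub f g

theorem letterSum_letterB (p s : List Letter) (k : ℕ+) (U : ℕ) :
    letterSum (p ++ letterB k :: s) U = letterSum (p ++ letterA k :: s) U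
      + (delta1 k * (1 / 2)) • letterSum (p ++ 1 :: s) U := by
  rw [letterB, letterSum_add, letterSum_smul]

theorem gsh_ds (u v : List ℕ+) :
    gsh (ds (word u) (word v)) = gsh (stuffleWord u v) - gshSeries u * gshSeries v := by
  rw [ds, map_sub, gsh_shuffle, gsh_word, gsh_word, stuffle, linExt_word, linExt_word]

end Membership

/-! ### Harmonic product against the product of nested sums. -/

section DoubleShuffle

theorem add_ne_one_pnat (a b : ℕ+) : a + b ≠ 1 := fun h => by
  have h' : (a : ℕ) + b = 1 := by rw [← PNat.add_coe, h, PNat.one_coe]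
  have := a.pos
  have := b.pos
  omega

theorem weight_nil : weight [] = 0 := rfl

theorem stuffleWord_one_two (a b c : ℕ+) : stuffleWord [a] [b, c]
    = word [a, b, c] + word [b, a, c] + word [b, c, a] + word [b, a + c] + word [a + b, c] := by
  simp only [stuffleWord, e, word_mul, mul_add, List.cons_append, List.nil_append]
  abel

theorem stuffleWord_one_three (a b c d : ℕ+) : stuffleWord [a] [b, c, d]
    = word [a, b, c, d] + word [b, a, c, d] + word [b, c, a, d] + word [b, c, d, a]
      + word [a + b, c, d] + word [b, a + c, d] + word [b, c, a + d] := by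
  rw [stuffleWord, stuffleWord_one_two]
  simp only [stuffleWord, e, word_mul, mul_add, List.cons_append, List.nil_append]
  abel

theorem stuffleWord_two_one (a b c : ℕ+) : stuffleWord [a, b] [c]
    = word [a, b, c] + word [a, c, b] + word [c, a, b] + word [a, b + c] + word [a + c, b] := by
  simp only [stuffleWord, e, word_mul, mul_add, List.cons_append, List.nil_append]
  abel

theorem stuffleWord_two_two (a b c d : ℕ+) : stuffleWord [a, b] [c, d]
    = word [a, b, c, d] + word [a, c, b, d] + word [a, c, d, b] + word [c, a, b, d]
      + word [c, a, d, b] + word [c, d, a, b] + word [a + c, b, d] + word [a + c, d, b]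
      + word [a, b + c, d] + word [a, c, b + d] + word [c, a, b + d] + word [c, a + d, b]
      + word [a + c, b + d] := by
  rw [stuffleWord, stuffleWord_one_two, stuffleWord_two_one]
  simp only [stuffleWord, e, word_mul, mul_add, List.cons_append, List.nil_append]
  abel

theorem truncFamily_gsh_word {w : List ℕ+} (hw : NoAdjacentOnes w) :
    truncFamily (gsh (word w)) = letterSum (letters w) 0 := by
  rw [gsh_word, truncFamily_gshSeries hw]

theorem letterSum_mul_one_two (f g h : Letter) : letterSum [f] 0 * letterSum [g, h] 0
    = letterSum [f, g, h] 0 + letterSum [g, f, h] 0 + letterSum [g, h, f] 0 + letterSum [g, f * h] 0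
      + letterSum [f * g, h] 0 := by
  rw [letterSum_mul]
  simp only [stuffleLists, List.map_cons, List.map_nil, List.sum_cons, List.sum_nil, List.nil_append,
    List.cons_append, add_zero]
  abel

theorem letterSum_mul_one_three (f g h i : Letter) : letterSum [f] 0 * letterSum [g, h, i] 0
    = letterSum [f, g, h, i] 0 + letterSum [g, f, h, i] 0 + letterSum [g, h, f, i] 0
      + letterSum [g, h, i, f] 0 + letterSum [f * g, h, i] 0 + letterSum [g, f * h, i] 0
      + letterSum [g, h, f * i] 0 := by
  rw [letterSum_mul]
  simp only [stuffleLists, List.map_cons, List.map_nil, List.sum_cons, List.sum_nil, List.nil_append,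
    List.cons_append, add_zero]
  abel

theorem letterSum_mul_two_two (f g h i : Letter) : letterSum [f, g] 0 * letterSum [h, i] 0
    = letterSum [f, g, h, i] 0 + letterSum [f, h, g, i] 0 + letterSum [f, h, i, g] 0
      + letterSum [h, f, g, i] 0 + letterSum [h, f, i, g] 0 + letterSum [h, i, f, g] 0
      + letterSum [f * h, g, i] 0 + letterSum [f * h, i, g] 0 + letterSum [f, g * h, i] 0
      + letterSum [f, h, g * i] 0 + letterSum [h, f, g * i] 0 + letterSum [h, f * i, g] 0
      + letterSum [f * h, g * i] 0 := by
  rw [letterSum_mul]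
  simp only [stuffleLists, List.map_cons, List.map_nil, List.sum_cons, List.sum_nil, List.nil_append,
    List.cons_append, add_zero]
  abel

/-- The product is computed from A_{k₁} and B_{k₂}, A_{k₃}, whereas `gsh` puts B on every letter
that is not last. The displayed half-terms are these mismatches, and the rest are merge defects of
lower weight. -/
theorem gsh_ds_one_two_sub_mem {k₁ k₂ k₃ : ℕ+} (h12 : k₁ ≠ 1 ∨ k₂ ≠ 1) (h13 : k₁ ≠ 1 ∨ k₃ ≠ 1)
    (h23 : k₂ ≠ 1 ∨ k₃ ≠ 1) :
    truncFamily (gsh (ds (word [k₁]) (word [k₂, k₃])))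
      - ((delta1 k₁ * (1 / 2)) • (letterSum [1, letterB k₂, letterA k₃] 0
            + letterSum [letterB k₂, 1, letterA k₃] 0)
        + (delta1 k₃ * (1 / 2)) • letterSum [letterB k₂, 1, letterA k₁] 0)
      ∈ GshT (k₁ + k₂ + k₃ - 1) := by
  have n12 := add_ne_one_pnat k₁ k₂
  have n13 := add_ne_one_pnat k₁ k₃
  have hp₁ := k₁.pos
  have hp₂ := k₂.pos
  have hp₃ := k₃.pos
  have key : truncFamily (gsh (ds (word [k₁]) (word [k₂, k₃])))
      - ((delta1 k₁ * (1 / 2)) • (letterSum [1, letterB k₂, letterA k₃] 0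
            + letterSum [letterB k₂, 1, letterA k₃] 0)
        + (delta1 k₃ * (1 / 2)) • letterSum [letterB k₂, 1, letterA k₁] 0)
      = letterSum [letterA (k₁ + k₂) - letterA k₁ * letterB k₂, letterA k₃] 0
        + letterSum [letterB k₂, letterA (k₁ + k₃) - letterA k₁ * letterA k₃] 0 := by
    rw [gsh_ds, map_sub, map_mul, stuffleWord_one_two]
    simp only [map_add]
    rw [truncFamily_gsh_word (w := [k₁, k₂, k₃]) ⟨h12, h23, trivial⟩,
      truncFamily_gsh_word (w := [k₂, k₁, k₃]) ⟨h12.symm, h13, trivial⟩,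
      truncFamily_gsh_word (w := [k₂, k₃, k₁]) ⟨h23, h13.symm, trivial⟩,
      truncFamily_gsh_word (w := [k₂, k₁ + k₃]) ⟨Or.inr n13, trivial⟩,
      truncFamily_gsh_word (w := [k₁ + k₂, k₃]) ⟨Or.inl n12, trivial⟩,
      truncFamily_gshSeries (k := [k₁]) trivial, truncFamily_gshSeries (k := [k₂, k₃]) ⟨h23, trivial⟩]
    simp only [letters]
    rw [letterSum_mul_one_two, letterB_of_ne_one n12]
    have e1 := letterSum_letterB [] [letterB k₂, letterA k₃] k₁ 0
    have e2 := letterSum_letterB [letterB k₂] [letterA k₃] k₁ 0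
    have e3 := letterSum_letterB [letterB k₂] [letterA k₁] k₃ 0
    have e4 := letterSum_sub [] [letterA k₃] (letterA (k₁ + k₂)) (letterA k₁ * letterB k₂) 0
    have e5 := letterSum_sub [letterB k₂] [] (letterA (k₁ + k₃)) (letterA k₁ * letterA k₃) 0
    simp only [List.cons_append, List.nil_append] at e1 e2 e3 e4 e5
    rw [e1, e2, e3, e4, e5]
    module
  rw [key]
  refine Submodule.add_mem _ ?_ ?_
  · refine letterSum_mem_of_lowLetters (p := []) (fun k hk hkn => ?_) (merge_AB_mem h12)
    have := letterSum_letters_mem (w := [k, k₃]) ⟨Or.inl hk, trivial⟩ (n := k₁ + k₂ + k₃ - 1)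
      (by simp only [weight_cons, weight_nil]; omega)
    simpa [letters, letterB_of_ne_one hk] using this
  · refine letterSum_mem_of_lowLetters (p := [letterB k₂]) (fun k hk hkn => ?_) (merge_AA_mem h13)
    exact letterSum_letters_mem (w := [k₂, k]) ⟨Or.inr hk, trivial⟩ (n := k₁ + k₂ + k₃ - 1)
      (by simp only [weight_cons, weight_nil]; omega)

theorem gsh_stuffleWord_one_two_mem (k₁ k₂ k₃ : ℕ+) :
    gsh (stuffleWord [k₁] [k₂, k₃]) ∈ GshLE (k₁ + k₂ + k₃) := by
  rw [stuffleWord_one_two]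
  simp only [map_add, gsh_word]
  refine Submodule.add_mem _ (Submodule.add_mem _ (Submodule.add_mem _ (Submodule.add_mem _ ?_ ?_) ?_)
    ?_) ?_ <;>
  · apply gshSeries_mem
    simp only [weight_cons, weight_nil, PNat.add_coe]
    omega

/-- Insertion of a free index between two letters of index at least two. -/
theorem letterSum_gap_mem {j k : ℕ+} (hj : j ≠ 1) (hk : k ≠ 1) :
    letterSum [letterA j, 1, letterA k] 0 ∈ GshT (j + k + 1) := by
  -- Taking the last letter of the pair to be e₁ leaves half of the wanted sum as the only mismatch
  -- term, while ds itself lies in the filtration because both products respect weight.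
  have h1 := gsh_ds_one_two_sub_mem (k₁ := k) (k₂ := j) (k₃ := 1) (Or.inl hk) (Or.inl hk) (Or.inl hj)
  have h2 : truncFamily (gsh (ds (word [k]) (word [j, 1]))) ∈ GshT (j + k + 1) := by
    rw [truncFamily_mem]
    have e : (k : ℕ) + j + (1 : ℕ+) = j + k + 1 := by rw [PNat.one_coe]; omega
    have hs := gsh_shuffle_mem [k] [j, 1]
    have hst := gsh_stuffleWord_one_two_mem k j 1
    rw [show weight [k] + weight [j, 1] = j + k + 1 by
      simp only [weight_cons, weight_nil, PNat.one_coe]; omega] at hs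
    rw [e] at hst
    rw [ds, map_sub, stuffle, linExt_word, linExt_word]
    exact Submodule.sub_mem _ hst hs
  have h3 := Submodule.sub_mem _ h2 (GshT_mono (by rw [PNat.one_coe]; omega) h1)
  have e1 : delta1 k = 0 := if_neg hk
  have e2 : delta1 1 = 1 := if_pos rfl
  rw [sub_sub_cancel, e1, e2, zero_mul, zero_smul, zero_add, one_mul, letterB_of_ne_one hj] at h3
  have := Submodule.smul_mem _ (2 : ℚ) h3
  rw [smul_smul] at this
  norm_num at this
  exact this

theorem gsh_ds_one_three_sub_mem {k₁ k₂ k₃ k₄ : ℕ+} (h12 : k₁ ≠ 1 ∨ k₂ ≠ 1) (h13 : k₁ ≠ 1 ∨ k₃ ≠ 1)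
    (h14 : k₁ ≠ 1 ∨ k₄ ≠ 1) (h23 : k₂ ≠ 1 ∨ k₃ ≠ 1) (h34 : k₃ ≠ 1 ∨ k₄ ≠ 1) :
    truncFamily (gsh (ds (word [k₁]) (word [k₂, k₃, k₄])))
      - ((delta1 k₁ * (1 / 2)) • (letterSum [1, letterB k₂, letterB k₃, letterA k₄] 0
            + letterSum [letterB k₂, 1, letterB k₃, letterA k₄] 0
            + letterSum [letterB k₂, letterB k₃, 1, letterA k₄] 0)
        + (delta1 k₄ * (1 / 2)) • letterSum [letterB k₂, letterB k₃, 1, letterA k₁] 0)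
      ∈ GshT (k₁ + k₂ + k₃ + k₄ - 1) := by
  have n12 := add_ne_one_pnat k₁ k₂
  have n13 := add_ne_one_pnat k₁ k₃
  have n14 := add_ne_one_pnat k₁ k₄
  have hp₁ := k₁.pos
  have hp₂ := k₂.pos
  have hp₃ := k₃.pos
  have hp₄ := k₄.pos
  have key : truncFamily (gsh (ds (word [k₁]) (word [k₂, k₃, k₄])))
      - ((delta1 k₁ * (1 / 2)) • (letterSum [1, letterB k₂, letterB k₃, letterA k₄] 0
            + letterSum [letterB k₂, 1, letterB k₃, letterA k₄] 0
            + letterSum [letterB k₂, letterB k₃, 1, letterA k₄] 0)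
        + (delta1 k₄ * (1 / 2)) • letterSum [letterB k₂, letterB k₃, 1, letterA k₁] 0)
      = letterSum [letterA (k₁ + k₂) - letterA k₁ * letterB k₂, letterB k₃, letterA k₄] 0
        + letterSum [letterB k₂, letterA (k₁ + k₃) - letterA k₁ * letterB k₃, letterA k₄] 0
        + letterSum [letterB k₂, letterB k₃, letterA (k₁ + k₄) - letterA k₁ * letterA k₄] 0 := by
    rw [gsh_ds, map_sub, map_mul, stuffleWord_one_three]
    simp only [map_add]
    rw [truncFamily_gsh_word (w := [k₁, k₂, k₃, k₄]) ⟨h12, h23, h34, trivial⟩,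
      truncFamily_gsh_word (w := [k₂, k₁, k₃, k₄]) ⟨h12.symm, h13, h34, trivial⟩,
      truncFamily_gsh_word (w := [k₂, k₃, k₁, k₄]) ⟨h23, h13.symm, h14, trivial⟩,
      truncFamily_gsh_word (w := [k₂, k₃, k₄, k₁]) ⟨h23, h34, h14.symm, trivial⟩,
      truncFamily_gsh_word (w := [k₁ + k₂, k₃, k₄]) ⟨Or.inl n12, h34, trivial⟩,
      truncFamily_gsh_word (w := [k₂, k₁ + k₃, k₄]) ⟨Or.inr n13, Or.inl n13, trivial⟩,
      truncFamily_gsh_word (w := [k₂, k₃, k₁ + k₄]) ⟨h23, Or.inr n14, trivial⟩,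
      truncFamily_gshSeries (k := [k₁]) trivial,
      truncFamily_gshSeries (k := [k₂, k₃, k₄]) ⟨h23, h34, trivial⟩]
    simp only [letters]
    rw [letterSum_mul_one_three, letterB_of_ne_one n12, letterB_of_ne_one n13]
    have e1 := letterSum_letterB [] [letterB k₂, letterB k₃, letterA k₄] k₁ 0
    have e2 := letterSum_letterB [letterB k₂] [letterB k₃, letterA k₄] k₁ 0
    have e3 := letterSum_letterB [letterB k₂, letterB k₃] [letterA k₄] k₁ 0
    have e4 := letterSum_letterB [letterB k₂, letterB k₃] [letterA k₁] k₄ 0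
    have e5 := letterSum_sub [] [letterB k₃, letterA k₄] (letterA (k₁ + k₂)) (letterA k₁ * letterB k₂) 0
    have e6 := letterSum_sub [letterB k₂] [letterA k₄] (letterA (k₁ + k₃)) (letterA k₁ * letterB k₃) 0
    have e7 := letterSum_sub [letterB k₂, letterB k₃] [] (letterA (k₁ + k₄)) (letterA k₁ * letterA k₄) 0
    simp only [List.cons_append, List.nil_append] at e1 e2 e3 e4 e5 e6 e7
    rw [e1, e2, e3, e4, e5, e6, e7]
    module
  rw [key]
  refine Submodule.add_mem _ (Submodule.add_mem _ ?_ ?_) ?_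
  · refine letterSum_mem_of_lowLetters (p := []) (fun k hk hkn => ?_) (merge_AB_mem h12)
    have := letterSum_letters_mem (w := [k, k₃, k₄]) ⟨Or.inl hk, h34, trivial⟩
      (n := k₁ + k₂ + k₃ + k₄ - 1)
      (by simp only [weight_cons, weight_nil]; omega)
    simpa [letters, letterB_of_ne_one hk] using this
  · refine letterSum_mem_of_lowLetters (p := [letterB k₂]) (fun k hk hkn => ?_) (merge_AB_mem h13)
    have := letterSum_letters_mem (w := [k₂, k, k₄]) ⟨Or.inr hk, Or.inl hk, trivial⟩
      (n := k₁ + k₂ + k₃ + k₄ - 1)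
      (by simp only [weight_cons, weight_nil]; omega)
    simpa [letters, letterB_of_ne_one hk] using this
  · refine letterSum_mem_of_lowLetters (p := [letterB k₂, letterB k₃]) (fun k hk hkn => ?_)
      (merge_AA_mem h14)
    exact letterSum_letters_mem (w := [k₂, k₃, k]) ⟨h23, Or.inr hk, trivial⟩
      (n := k₁ + k₂ + k₃ + k₄ - 1)
      (by simp only [weight_cons, weight_nil]; omega)

theorem letterSum_merged_pair_mem {a b n : ℕ} {f g : Letter} (hf : f ∈ lowLetters a)
    (hg : g ∈ lowLetters b) (h : a + b ≤ n) : letterSum [f, g] 0 ∈ GshT n := by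
  refine letterSum_mem_of_lowLetters (p := []) (fun k hk hka => ?_) hf
  refine letterSum_mem_of_lowLetters (p := [letterA k]) (fun l hl hlb => ?_) hg
  have := letterSum_letters_mem (w := [k, l]) ⟨Or.inl hk, trivial⟩ (n := n)
    (by simp only [weight_cons, weight_nil]; omega)
  simpa [letters, letterB_of_ne_one hk] using this

theorem gsh_ds_two_two_sub_mem {k₁ k₂ k₃ k₄ : ℕ+} (h12 : k₁ ≠ 1 ∨ k₂ ≠ 1) (h13 : k₁ ≠ 1 ∨ k₃ ≠ 1)
    (h14 : k₁ ≠ 1 ∨ k₄ ≠ 1) (h23 : k₂ ≠ 1 ∨ k₃ ≠ 1) (h24 : k₂ ≠ 1 ∨ k₄ ≠ 1) (h34 : k₃ ≠ 1 ∨ k₄ ≠ 1) :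
    truncFamily (gsh (ds (word [k₁, k₂]) (word [k₃, k₄])))
      - ((delta1 k₂ * (1 / 2)) • (letterSum [letterB k₁, 1, letterB k₃, letterA k₄] 0
            + letterSum [letterB k₁, letterB k₃, 1, letterA k₄] 0
            + letterSum [letterB k₃, letterB k₁, 1, letterA k₄] 0
            + letterSum [letterA (k₁ + k₃), 1, letterA k₄] 0)
        + (delta1 k₄ * (1 / 2)) • (letterSum [letterB k₁, letterB k₃, 1, letterA k₂] 0
            + letterSum [letterB k₃, letterB k₁, 1, letterA k₂] 0
            + letterSum [letterB k₃, 1, letterB k₁, letterA k₂] 0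
            + letterSum [letterA (k₁ + k₃), 1, letterA k₂] 0))
      ∈ GshT (k₁ + k₂ + k₃ + k₄ - 1) := by
  have n13 := add_ne_one_pnat k₁ k₃
  have n14 := add_ne_one_pnat k₁ k₄
  have n23 := add_ne_one_pnat k₂ k₃
  have n24 := add_ne_one_pnat k₂ k₄
  have hp₁ := k₁.pos
  have hp₂ := k₂.pos
  have hp₃ := k₃.pos
  have hp₄ := k₄.pos
  set m13 := letterA (k₁ + k₃) - letterB k₁ * letterB k₃ with hm13
  set m24 := letterA (k₂ + k₄) - letterA k₂ * letterA k₄ with hm24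
  have key : truncFamily (gsh (ds (word [k₁, k₂]) (word [k₃, k₄])))
      - ((delta1 k₂ * (1 / 2)) • (letterSum [letterB k₁, 1, letterB k₃, letterA k₄] 0
            + letterSum [letterB k₁, letterB k₃, 1, letterA k₄] 0
            + letterSum [letterB k₃, letterB k₁, 1, letterA k₄] 0
            + letterSum [letterA (k₁ + k₃), 1, letterA k₄] 0)
        + (delta1 k₄ * (1 / 2)) • (letterSum [letterB k₁, letterB k₃, 1, letterA k₂] 0
            + letterSum [letterB k₃, letterB k₁, 1, letterA k₂] 0
            + letterSum [letterB k₃, 1, letterB k₁, letterA k₂] 0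
            + letterSum [letterA (k₁ + k₃), 1, letterA k₂] 0))
      = (letterSum [m13, letterB k₂, letterA k₄] 0
          - (delta1 k₂ * (1 / 2)) • letterSum [m13, 1, letterA k₄] 0)
        + (letterSum [m13, letterB k₄, letterA k₂] 0
          - (delta1 k₄ * (1 / 2)) • letterSum [m13, 1, letterA k₂] 0)
        + letterSum [letterB k₁, letterA (k₂ + k₃) - letterA k₂ * letterB k₃, letterA k₄] 0
        + letterSum [letterB k₁, letterB k₃, m24] 0
        + letterSum [letterB k₃, letterB k₁, m24] 0
        + letterSum [letterB k₃, letterA (k₁ + k₄) - letterB k₁ * letterA k₄, letterA k₂] 0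
        -- When both positions merge, the difference of products is expanded as xy - (x - m)(y - m')
        -- = my + xm' - mm'.
        + (letterSum [m13, letterA (k₂ + k₄)] 0 + letterSum [letterA (k₁ + k₃), m24] 0
          - letterSum [m13, m24] 0) := by
    rw [gsh_ds, map_sub, map_mul, stuffleWord_two_two]
    simp only [map_add]
    rw [truncFamily_gsh_word (w := [k₁, k₂, k₃, k₄]) ⟨h12, h23, h34, trivial⟩,
      truncFamily_gsh_word (w := [k₁, k₃, k₂, k₄]) ⟨h13, h23.symm, h24, trivial⟩,
      truncFamily_gsh_word (w := [k₁, k₃, k₄, k₂]) ⟨h13, h34, h24.symm, trivial⟩,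
      truncFamily_gsh_word (w := [k₃, k₁, k₂, k₄]) ⟨h13.symm, h12, h24, trivial⟩,
      truncFamily_gsh_word (w := [k₃, k₁, k₄, k₂]) ⟨h13.symm, h14, h24.symm, trivial⟩,
      truncFamily_gsh_word (w := [k₃, k₄, k₁, k₂]) ⟨h34, h14.symm, h12, trivial⟩,
      truncFamily_gsh_word (w := [k₁ + k₃, k₂, k₄]) ⟨Or.inl n13, h24, trivial⟩,
      truncFamily_gsh_word (w := [k₁ + k₃, k₄, k₂]) ⟨Or.inl n13, h24.symm, trivial⟩,
      truncFamily_gsh_word (w := [k₁, k₂ + k₃, k₄]) ⟨Or.inr n23, Or.inl n23, trivial⟩,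
      truncFamily_gsh_word (w := [k₁, k₃, k₂ + k₄]) ⟨h13, Or.inr n24, trivial⟩,
      truncFamily_gsh_word (w := [k₃, k₁, k₂ + k₄]) ⟨h13.symm, Or.inr n24, trivial⟩,
      truncFamily_gsh_word (w := [k₃, k₁ + k₄, k₂]) ⟨Or.inr n14, Or.inl n14, trivial⟩,
      truncFamily_gsh_word (w := [k₁ + k₃, k₂ + k₄]) ⟨Or.inl n13, trivial⟩,
      truncFamily_gshSeries (k := [k₁, k₂]) ⟨h12, trivial⟩,
      truncFamily_gshSeries (k := [k₃, k₄]) ⟨h34, trivial⟩]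
    simp only [letters]
    rw [letterSum_mul_two_two, letterB_of_ne_one n13, letterB_of_ne_one n14, letterB_of_ne_one n23]
    have e1 := letterSum_letterB [letterB k₁] [letterB k₃, letterA k₄] k₂ 0
    have e2 := letterSum_letterB [letterB k₁, letterB k₃] [letterA k₄] k₂ 0
    have e3 := letterSum_letterB [letterB k₃, letterB k₁] [letterA k₄] k₂ 0
    have e4 := letterSum_letterB [letterB k₁, letterB k₃] [letterA k₂] k₄ 0
    have e5 := letterSum_letterB [letterB k₃, letterB k₁] [letterA k₂] k₄ 0
    have e6 := letterSum_letterB [letterB k₃] [letterB k₁, letterA k₂] k₄ 0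
    have e7 := letterSum_letterB [letterA (k₁ + k₃)] [letterA k₄] k₂ 0
    have e8 := letterSum_letterB [letterA (k₁ + k₃)] [letterA k₂] k₄ 0
    have e9 := letterSum_letterB [m13] [letterA k₄] k₂ 0
    have e10 := letterSum_letterB [m13] [letterA k₂] k₄ 0
    have e11 := letterSum_sub [] [letterA k₂, letterA k₄] (letterA (k₁ + k₃)) (letterB k₁ * letterB k₃) 0
    have e12 := letterSum_sub [] [letterA k₄, letterA k₂] (letterA (k₁ + k₃)) (letterB k₁ * letterB k₃) 0
    have e13 := letterSum_sub [letterB k₁] [letterA k₄] (letterA (k₂ + k₃)) (letterA k₂ * letterB k₃) 0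
    have e14 := letterSum_sub [letterB k₁, letterB k₃] [] (letterA (k₂ + k₄)) (letterA k₂ * letterA k₄) 0
    have e15 := letterSum_sub [letterB k₃, letterB k₁] [] (letterA (k₂ + k₄)) (letterA k₂ * letterA k₄) 0
    have e16 := letterSum_sub [letterB k₃] [letterA k₂] (letterA (k₁ + k₄)) (letterB k₁ * letterA k₄) 0
    have e17 := letterSum_sub [] [letterA (k₂ + k₄)] (letterA (k₁ + k₃)) (letterB k₁ * letterB k₃) 0
    have e18 := letterSum_sub [letterA (k₁ + k₃)] [] (letterA (k₂ + k₄)) (letterA k₂ * letterA k₄) 0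
    have e19 := letterSum_sub [m13] [] (letterA (k₂ + k₄)) (letterA k₂ * letterA k₄) 0
    have e20 := letterSum_sub [] [letterA k₂ * letterA k₄] (letterA (k₁ + k₃)) (letterB k₁ * letterB k₃) 0
    simp only [List.cons_append, List.nil_append] at e1 e2 e3 e4 e5 e6 e7 e8 e9 e10
    simp only [List.cons_append, List.nil_append, ← hm13, ← hm24] at e11 e12 e13 e14 e15 e16 e17 e18 e19 e20
    rw [e1, e2, e3, e4, e5, e6, e7, e8, e9, e10, e11, e12, e13, e14, e15, e16, e17, e18, e19, e20, e17]
    module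
  have hm13' : m13 ∈ lowLetters (k₁ + k₃ - 1) := merge_BB_mem h13
  have hm24' : m24 ∈ lowLetters (k₂ + k₄ - 1) := merge_AA_mem h24
  have hA13 : letterA (k₁ + k₃) ∈ lowLetters (k₁ + k₃) := letterA_mem n13 le_rfl
  have hA24 : letterA (k₂ + k₄) ∈ lowLetters (k₂ + k₄) := letterA_mem n24 le_rfl
  -- The sum with `letterA a` in the middle is rewritten with `letterB a`, so that a shuffle
  -- q-series appears. For a = 1 the correction has a free index; `letterSum_gap_mem` raises the
  -- weight of its two letters by only one, and the drop in `m13` compensates.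
  have hgap (a b : ℕ+) (hab : a ≠ 1 ∨ b ≠ 1) (hn : (a : ℕ) + b = k₂ + k₄) :
      letterSum [m13, letterB a, letterA b] 0 - (delta1 a * (1 / 2)) • letterSum [m13, 1, letterA b] 0
        ∈ GshT (k₁ + k₂ + k₃ + k₄ - 1) := by
    refine Submodule.sub_mem _ ?_ ?_
    · refine letterSum_mem_of_lowLetters (p := []) (fun k hk hkn => ?_) hm13'
      have := letterSum_letters_mem (w := [k, a, b]) ⟨Or.inl hk, hab, trivial⟩
        (n := k₁ + k₂ + k₃ + k₄ - 1)
        (by simp only [weight_cons, weight_nil]; omega)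
      simpa [letters, letterB_of_ne_one hk] using this
    · by_cases ha : a = 1
      · refine Submodule.smul_mem _ _ ?_
        refine letterSum_mem_of_lowLetters (p := []) (fun k hk hkn => ?_) hm13'
        refine GshT_mono ?_ (letterSum_gap_mem hk (show b ≠ 1 by simpa [ha] using hab))
        rw [ha, PNat.one_coe] at hn
        omega
      · rw [delta1, if_neg ha, zero_mul, zero_smul]; exact Submodule.zero_mem _
  rw [key]
  refine Submodule.add_mem _ (Submodule.add_mem _ (Submodule.add_mem _ (Submodule.add_mem _
    (Submodule.add_mem _ (Submodule.add_mem _ ?_ ?_) ?_) ?_) ?_) ?_) ?_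
  · exact hgap k₂ k₄ h24 rfl
  · exact hgap k₄ k₂ h24.symm (add_comm _ _)
  · refine letterSum_mem_of_lowLetters (p := [letterB k₁]) (fun k hk hkn => ?_) (merge_AB_mem h23)
    have := letterSum_letters_mem (w := [k₁, k, k₄]) ⟨Or.inr hk, Or.inl hk, trivial⟩
      (n := k₁ + k₂ + k₃ + k₄ - 1)
      (by simp only [weight_cons, weight_nil]; omega)
    simpa [letters, letterB_of_ne_one hk] using this
  · refine letterSum_mem_of_lowLetters (p := [letterB k₁, letterB k₃]) (fun k hk hkn => ?_) hm24'
    exact letterSum_letters_mem (w := [k₁, k₃, k]) ⟨h13, Or.inr hk, trivial⟩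
      (by simp only [weight_cons, weight_nil]; omega)
  · refine letterSum_mem_of_lowLetters (p := [letterB k₃, letterB k₁]) (fun k hk hkn => ?_) hm24'
    exact letterSum_letters_mem (w := [k₃, k₁, k]) ⟨h13.symm, Or.inr hk, trivial⟩
      (by simp only [weight_cons, weight_nil]; omega)
  · refine letterSum_mem_of_lowLetters (p := [letterB k₃]) (fun k hk hkn => ?_) (merge_BA_mem h14)
    have := letterSum_letters_mem (w := [k₃, k, k₂]) ⟨Or.inr hk, Or.inl hk, trivial⟩
      (n := k₁ + k₂ + k₃ + k₄ - 1)
      (by simp only [weight_cons, weight_nil]; omega)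
    simpa [letters, letterB_of_ne_one hk] using this
  · refine Submodule.sub_mem _ (Submodule.add_mem _ ?_ ?_) ?_
    · exact letterSum_merged_pair_mem hm13' hA24 (by omega)
    · exact letterSum_merged_pair_mem hA13 hm24' (by omega)
    · exact letterSum_merged_pair_mem hm13' hm24' (by omega)

end DoubleShuffle

/-! ### Summing out the free index to obtain bi-brackets. -/

section Reduction

theorem truncFamily_g_zero_one (a b : ℕ+) :
    truncFamily (g ![0, 1] ![a, b]) = letterSum [letterA a, indexLetter * letterA b] 0 := by
  rw [truncFamily_g]
  simp [List.ofFn_succ]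

theorem truncFamily_g_one_zero (a b : ℕ+) :
    truncFamily (g ![1, 0] ![a, b]) = letterSum [indexLetter * letterA a, letterA b] 0 := by
  rw [truncFamily_g]
  simp [List.ofFn_succ]

theorem truncFamily_g_zero_zero_one (a b c : ℕ+) : truncFamily (g ![0, 0, 1] ![a, b, c])
    = letterSum [letterA a, letterA b, indexLetter * letterA c] 0 := by
  rw [truncFamily_g]
  simp [List.ofFn_succ]

theorem truncFamily_g_zero_one_zero (a b c : ℕ+) : truncFamily (g ![0, 1, 0] ![a, b, c])
    = letterSum [letterA a, indexLetter * letterA b, letterA c] 0 := by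
  rw [truncFamily_g]
  simp [List.ofFn_succ]

theorem truncFamily_g_one_zero_zero (a b c : ℕ+) : truncFamily (g ![1, 0, 0] ![a, b, c])
    = letterSum [indexLetter * letterA a, letterA b, letterA c] 0 := by
  rw [truncFamily_g]
  simp [List.ofFn_succ]

theorem delta1_smul_mem {M : Type*} [AddCommGroup M] [Module ℚ M] (S : Submodule ℚ M) {a : ℕ+} {x : M}
    (h : a = 1 → x ∈ S) : (delta1 a * (1 / 2)) • x ∈ S := by
  by_cases ha : a = 1
  · exact Submodule.smul_mem _ _ (h ha)
  · rw [delta1, if_neg ha, zero_mul, zero_smul]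
    exact Submodule.zero_mem _

theorem letterSum_pair_mem {a b : ℕ+} {n : ℕ} (ha : a ≠ 1) (h : (a : ℕ) + b ≤ n) :
    letterSum [letterA a, letterA b] 0 ∈ GshT n := by
  have := letterSum_letters_mem (w := [a, b]) ⟨Or.inl ha, trivial⟩ (n := n)
    (by simpa only [weight_cons, weight_nil, add_zero] using h)
  simpa only [letters, letterB_of_ne_one ha] using this

theorem letterSum_triple_mem {a b c : ℕ+} {n : ℕ} (ha : a ≠ 1) (hb : b ≠ 1) (h : (a : ℕ) + b + c ≤ n) :
    letterSum [letterA a, letterA b, letterA c] 0 ∈ GshT n := by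
  have := letterSum_letters_mem (w := [a, b, c]) ⟨Or.inl ha, Or.inl hb, trivial⟩ (n := n)
    (by simpa only [weight_cons, weight_nil, add_zero, ← add_assoc] using h)
  simpa only [letters, letterB_of_ne_one ha, letterB_of_ne_one hb] using this

theorem letterSum_one_pair (f g : Letter) : letterSum [1, f, g] 0
    = letterSum [indexLetter * f, g] 0 - letterSum [f, g] 0 := by
  rw [letterSum_one_cons]; simp

theorem letterSum_pair_one (f g : Letter) : letterSum [f, 1, g] 0
    = letterSum [f, indexLetter * g] 0 - letterSum [indexLetter * f, g] 0 - letterSum [f, g] 0 :=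
  letterSum_insert_one [] f g [] 0

theorem letterSum_one_triple (f g h : Letter) : letterSum [1, f, g, h] 0
    = letterSum [indexLetter * f, g, h] 0 - letterSum [f, g, h] 0 := by
  rw [letterSum_one_cons]; simp

theorem letterSum_insert_one_first (f g h : Letter) : letterSum [f, 1, g, h] 0
    = letterSum [f, indexLetter * g, h] 0 - letterSum [indexLetter * f, g, h] 0 - letterSum [f, g, h] 0 :=
  letterSum_insert_one [] f g [h] 0

theorem letterSum_insert_one_second (f g h : Letter) : letterSum [f, g, 1, h] 0
    = letterSum [f, g, indexLetter * h] 0 - letterSum [f, indexLetter * g, h] 0 - letterSum [f, g, h] 0 :=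
  letterSum_insert_one [f] g h [] 0

theorem sModEq_of_sub_mem {f f' : ℚ⟦X⟧} {n : ℕ} {x : ∀ N, Trunc N} (h : truncFamily f - x ∈ GshT n)
    (h' : x - truncFamily f' ∈ GshT n) : f ≡ f' [SMOD GshLE n] := by
  rw [SModEq.sub_mem, ← truncFamily_mem, map_sub]
  simpa using Submodule.add_mem _ h h'

theorem gsh_ds_one_two {k₁ k₂ k₃ : ℕ+} (h12 : k₁ ≠ 1 ∨ k₂ ≠ 1) (h13 : k₁ ≠ 1 ∨ k₃ ≠ 1)
    (h23 : k₂ ≠ 1 ∨ k₃ ≠ 1) :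
    gsh (ds (word [k₁]) (word [k₂, k₃])) ≡
        (delta1 k₁ * (1 / 2)) • g ![0, 1] ![k₂, k₃]
        + (delta1 k₃ * (1 / 2)) • (g ![0, 1] ![k₂, k₁] - g ![1, 0] ![k₂, k₁])
      [SMOD GshLE ((k₁ : ℕ) + k₂ + k₃ - 1)] := by
  refine sModEq_of_sub_mem (gsh_ds_one_two_sub_mem h12 h13 h23) ?_
  simp only [map_add, map_sub, map_smul, truncFamily_g_zero_one, truncFamily_g_one_zero]
  rw [add_sub_add_comm, ← smul_sub, ← smul_sub]
  refine Submodule.add_mem _ (delta1_smul_mem _ fun h => ?_) (delta1_smul_mem _ fun h => ?_)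
  · have hk₂ : k₂ ≠ 1 := by tauto
    have hm := letterSum_pair_mem (b := k₃) (n := k₁ + k₂ + k₃ - 1) hk₂ (by rw [h, PNat.one_coe]; omega)
    -- The index factor on the first letter cancels between the two insertions; each costs one plain
    -- sum, whence -2.
    rw [letterB_of_ne_one hk₂, letterSum_one_pair, letterSum_pair_one]
    convert Submodule.smul_mem _ (-2 : ℚ) hm using 1
    module
  · have hk₂ : k₂ ≠ 1 := by tauto
    have hm := letterSum_pair_mem (b := k₁) (n := k₁ + k₂ + k₃ - 1) hk₂ (by rw [h, PNat.one_coe]; omega)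
    rw [letterB_of_ne_one hk₂, letterSum_pair_one]
    convert Submodule.smul_mem _ (-1 : ℚ) hm using 1
    module

theorem gsh_ds_one_three {k₁ k₂ k₃ k₄ : ℕ+} (h12 : k₁ ≠ 1 ∨ k₂ ≠ 1) (h13 : k₁ ≠ 1 ∨ k₃ ≠ 1)
    (h14 : k₁ ≠ 1 ∨ k₄ ≠ 1) (h23 : k₂ ≠ 1 ∨ k₃ ≠ 1) (h24 : k₂ ≠ 1 ∨ k₄ ≠ 1) (h34 : k₃ ≠ 1 ∨ k₄ ≠ 1) :
    gsh (ds (word [k₁]) (word [k₂, k₃, k₄])) ≡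
        (delta1 k₁ * (1 / 2)) • g ![0, 0, 1] ![k₂, k₃, k₄]
        + (delta1 k₄ * (1 / 2)) • (g ![0, 0, 1] ![k₂, k₃, k₁] - g ![0, 1, 0] ![k₂, k₃, k₁])
      [SMOD GshLE ((k₁ : ℕ) + k₂ + k₃ + k₄ - 1)] := by
  refine sModEq_of_sub_mem (gsh_ds_one_three_sub_mem h12 h13 h14 h23 h34) ?_
  simp only [map_add, map_sub, map_smul, truncFamily_g_zero_zero_one, truncFamily_g_zero_one_zero]
  rw [add_sub_add_comm, ← smul_sub, ← smul_sub]
  refine Submodule.add_mem _ (delta1_smul_mem _ fun h => ?_) (delta1_smul_mem _ fun h => ?_)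
  · have hk₂ : k₂ ≠ 1 := by tauto
    have hk₃ : k₃ ≠ 1 := by tauto
    have hm := letterSum_triple_mem (c := k₄) (n := k₁ + k₂ + k₃ + k₄ - 1) hk₂ hk₃
      (by rw [h, PNat.one_coe]; omega)
    -- The three insertions telescope to the index factor on the last letter, with one plain sum
    -- lost each time.
    rw [letterB_of_ne_one hk₂, letterB_of_ne_one hk₃, letterSum_one_triple, letterSum_insert_one_first,
      letterSum_insert_one_second]
    convert Submodule.smul_mem _ (-3 : ℚ) hm using 1
    module
  · have hk₂ : k₂ ≠ 1 := by tauto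
    have hk₃ : k₃ ≠ 1 := by tauto
    have hm := letterSum_triple_mem (c := k₁) (n := k₁ + k₂ + k₃ + k₄ - 1) hk₂ hk₃
      (by rw [h, PNat.one_coe]; omega)
    rw [letterB_of_ne_one hk₂, letterB_of_ne_one hk₃, letterSum_insert_one_second]
    convert Submodule.smul_mem _ (-1 : ℚ) hm using 1
    module

theorem gsh_ds_two_two {k₁ k₂ k₃ k₄ : ℕ+} (h12 : k₁ ≠ 1 ∨ k₂ ≠ 1) (h13 : k₁ ≠ 1 ∨ k₃ ≠ 1)
    (h14 : k₁ ≠ 1 ∨ k₄ ≠ 1) (h23 : k₂ ≠ 1 ∨ k₃ ≠ 1) (h24 : k₂ ≠ 1 ∨ k₄ ≠ 1) (h34 : k₃ ≠ 1 ∨ k₄ ≠ 1) :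
    gsh (ds (word [k₁, k₂]) (word [k₃, k₄])) ≡
        (delta1 k₂ * (1 / 2)) • (g ![0, 0, 1] ![k₁, k₃, k₄] - g ![1, 0, 0] ![k₁, k₃, k₄]
          + g ![0, 0, 1] ![k₃, k₁, k₄] - g ![0, 1, 0] ![k₃, k₁, k₄])
        + (delta1 k₂ * (1 / 2)) • (g ![0, 1] ![k₁ + k₃, k₄] - g ![1, 0] ![k₁ + k₃, k₄])
        + (delta1 k₄ * (1 / 2)) • (g ![0, 0, 1] ![k₁, k₃, k₂] - g ![0, 1, 0] ![k₁, k₃, k₂]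
          + g ![0, 0, 1] ![k₃, k₁, k₂] - g ![1, 0, 0] ![k₃, k₁, k₂])
        + (delta1 k₄ * (1 / 2)) • (g ![0, 1] ![k₁ + k₃, k₂] - g ![1, 0] ![k₁ + k₃, k₂])
      [SMOD GshLE ((k₁ : ℕ) + k₂ + k₃ + k₄ - 1)] := by
  refine sModEq_of_sub_mem (gsh_ds_two_two_sub_mem h12 h13 h14 h23 h24 h34) ?_
  simp only [map_add, map_sub, map_smul, truncFamily_g_zero_zero_one, truncFamily_g_zero_one_zero,
    truncFamily_g_one_zero_zero, truncFamily_g_zero_one, truncFamily_g_one_zero]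
  rw [← smul_add, add_assoc (_ • _) (_ • _) (_ • _), ← smul_add, add_sub_add_comm, ← smul_sub, ← smul_sub]
  have n13 := add_ne_one_pnat k₁ k₃
  have hmem (c d : ℕ+) (h : d = 1) (hn : (c : ℕ) + d = k₂ + k₄) (hk₁ : k₁ ≠ 1) (hk₃ : k₃ ≠ 1) :
      letterSum [letterA k₁, letterA k₃, letterA c] 0 ∈ GshT (k₁ + k₂ + k₃ + k₄ - 1) ∧
      letterSum [letterA k₃, letterA k₁, letterA c] 0 ∈ GshT (k₁ + k₂ + k₃ + k₄ - 1) ∧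
      letterSum [letterA (k₁ + k₃), letterA c] 0 ∈ GshT (k₁ + k₂ + k₃ + k₄ - 1) := by
    rw [h, PNat.one_coe] at hn
    refine ⟨letterSum_triple_mem hk₁ hk₃ ?_, letterSum_triple_mem hk₃ hk₁ ?_, letterSum_pair_mem n13 ?_⟩
    · omega
    · omega
    · rw [PNat.add_coe]; omega
  refine Submodule.add_mem _ (delta1_smul_mem _ fun h => ?_) (delta1_smul_mem _ fun h => ?_)
  · have hk₁ : k₁ ≠ 1 := by tauto
    have hk₃ : k₃ ≠ 1 := by tauto
    obtain ⟨m1, m2, m3⟩ := hmem k₄ k₂ h (add_comm _ _) hk₁ hk₃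
    -- The two insertions into the order k₁, k₃, k₄ telescope, leaving the last index factor minus
    -- the first; the other two sums receive a single insertion each.
    rw [letterB_of_ne_one hk₁, letterB_of_ne_one hk₃, letterSum_insert_one_first,
      letterSum_insert_one_second, letterSum_insert_one_second, letterSum_pair_one]
    convert Submodule.add_mem _ (Submodule.add_mem _ (Submodule.smul_mem _ (-2 : ℚ) m1)
      (Submodule.smul_mem _ (-1 : ℚ) m2)) (Submodule.smul_mem _ (-1 : ℚ) m3) using 1
    module
  · have hk₁ : k₁ ≠ 1 := by tauto
    have hk₃ : k₃ ≠ 1 := by tauto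
    obtain ⟨m1, m2, m3⟩ := hmem k₂ k₄ h rfl hk₁ hk₃
    rw [letterB_of_ne_one hk₁, letterB_of_ne_one hk₃, letterSum_insert_one_second,
      letterSum_insert_one_second, letterSum_insert_one_first, letterSum_pair_one]
    convert Submodule.add_mem _ (Submodule.add_mem _ (Submodule.smul_mem _ (-1 : ℚ) m1)
      (Submodule.smul_mem _ (-2 : ℚ) m2)) (Submodule.smul_mem _ (-1 : ℚ) m3) using 1
    module

end Reduction

end MultEis

theorem lemma4p7 (k₁ k₂ k₃ k₄ : ℕ+) (h : ∃! j : Fin 4, ![k₁, k₂, k₃, k₄] j = 1) :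
    (gsh (ds (e k₁) (e k₂ * e k₃)) ≡
        (delta1 k₁ * (1 / 2)) • g ![0, 1] ![k₂, k₃]
        + (delta1 k₃ * (1 / 2)) • (g ![0, 1] ![k₂, k₁] - g ![1, 0] ![k₂, k₁])
      [SMOD GshLE ((k₁ : ℕ) + k₂ + k₃ - 1)]) ∧
    (gsh (ds (e k₁) (e k₂ * e k₃ * e k₄)) ≡
        (delta1 k₁ * (1 / 2)) • g ![0, 0, 1] ![k₂, k₃, k₄]
        + (delta1 k₄ * (1 / 2)) • (g ![0, 0, 1] ![k₂, k₃, k₁] - g ![0, 1, 0] ![k₂, k₃, k₁])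
      [SMOD GshLE ((k₁ : ℕ) + k₂ + k₃ + k₄ - 1)]) ∧
    (gsh (ds (e k₁ * e k₂) (e k₃ * e k₄)) ≡
        (delta1 k₂ * (1 / 2)) • (g ![0, 0, 1] ![k₁, k₃, k₄] - g ![1, 0, 0] ![k₁, k₃, k₄]
          + g ![0, 0, 1] ![k₃, k₁, k₄] - g ![0, 1, 0] ![k₃, k₁, k₄])
        + (delta1 k₂ * (1 / 2)) • (g ![0, 1] ![k₁ + k₃, k₄] - g ![1, 0] ![k₁ + k₃, k₄])
        + (delta1 k₄ * (1 / 2)) • (g ![0, 0, 1] ![k₁, k₃, k₂] - g ![0, 1, 0] ![k₁, k₃, k₂]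
          + g ![0, 0, 1] ![k₃, k₁, k₂] - g ![1, 0, 0] ![k₃, k₁, k₂])
        + (delta1 k₄ * (1 / 2)) • (g ![0, 1] ![k₁ + k₃, k₂] - g ![1, 0] ![k₁ + k₃, k₂])
      [SMOD GshLE ((k₁ : ℕ) + k₂ + k₃ + k₄ - 1)]) := by
  -- Uniqueness means that two different positions never both carry 1. Hence no word in the harmonic
  -- products has adjacent e₁'s, and A₁ is never merged with A₁.
  have hne {i j : Fin 4} (hij : i ≠ j) : ![k₁, k₂, k₃, k₄] i ≠ 1 ∨ ![k₁, k₂, k₃, k₄] j ≠ 1 := by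
    by_contra! hc
    exact hij (h.unique hc.1 hc.2)
  have h12 : k₁ ≠ 1 ∨ k₂ ≠ 1 := hne (i := 0) (j := 1) (by decide)
  have h13 : k₁ ≠ 1 ∨ k₃ ≠ 1 := hne (i := 0) (j := 2) (by decide)
  have h14 : k₁ ≠ 1 ∨ k₄ ≠ 1 := hne (i := 0) (j := 3) (by decide)
  have h23 : k₂ ≠ 1 ∨ k₃ ≠ 1 := hne (i := 1) (j := 2) (by decide)
  have h24 : k₂ ≠ 1 ∨ k₄ ≠ 1 := hne (i := 1) (j := 3) (by decide)
  have h34 : k₃ ≠ 1 ∨ k₄ ≠ 1 := hne (i := 2) (j := 3) (by decide)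
  simp only [e, word_mul, List.cons_append, List.nil_append]
  exact ⟨gsh_ds_one_two h12 h13 h23, gsh_ds_one_three h12 h13 h14 h23 h24 h34,
    gsh_ds_two_two h12 h13 h14 h23 h24 h34⟩
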